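/- Let $S$ be a finite set of prime numbers and let $\mathbb{Z}_S\subseteq\mathbb{Q}$ be the localization of $\mathbb{Z}$ at the set of nonzero integers not divisible by any prime in $S$. Let $A$ be a finite-dimensional semisimple $\mathbb{Q}$-algebra with irreducible central idempotents $e_1,\dots,e_m$, let $\mathfrak{O}$ be a maximal $\mathbb{Z}_S$-order in $A$ (so that $e_1,\dots,e_m\in\mathfrak{O}$), and let $u=(u_1,\dots,u_m)\in\mathbb{Q}^m$ with $u_i\ge 0$ for all $i$. For a finite (left) $\mathfrak{O}$-module $G$ put $|G|^u:=\prod_{i=1}^m|e_iG|^{u_i}$, let $\operatorname{Aut}_{\mathfrak O}(G)$ be its automorphism group, and let $\operatorname{Sur}_{\mathfrak O}(H,G)$ be the set of surjective $\mathfrak{O}$-module homomorphisms $H\to G$. Put \[ Z(u):=\sum_{G}\frac{1}{|G|^u\,|\operatorname{Aut}_{\mathfrak O}(G)|}, \] where $G$ runs over the isomorphism classes of finite $\mathfrak{O}$-modules. Let $(X_n)_{n\ge 0}$ be a sequence of random finite $\mathfrak{O}$-modules (possibly on different probability spaces) such that for every finite $\mathfrak{O}$-module $G$ \[ \lim_{n\to\infty}\mathbb{E}\big(|\operatorname{Sur}_{\mathfrak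 O}(X_n,G)|\big)=\frac{1}{|G|^u}. \] Then the series $Z(u)$ converges and, for every finite $\mathfrak{O}$-module $G$, the limit of $\mathbb{P}(X_n\cong G)$ exists and \[ \lim_{n\to\infty}\mathbb{P}(X_n\cong G)=\frac{1}{|\operatorname{Aut}_{\mathfrak O}(G)|\,|G|^u\,Z(u)}. \] That is, the limit is the Cohen--Lenstra--Martinet distribution: there is exactly one probability distribution $\mathbb{P}(X\cong\,\cdot\,)$ on the isomorphism classes of finite $\mathfrak{O}$-modules with \[ \frac{\mathbb{P}(X\cong G_1)}{\mathbb{P}(X\cong G_2)}=\frac{|G_2|^u\,|\operatorname{Aut}_{\mathfrak O}(G_2)|}{|G_1|^u\,|\operatorname{Aut}_{\mathfrak O}(G_1)|} \] for all finite $\mathfrak{O}$-modules $G_1,G_2$, and $\lim_{n\to\infty}\mathbb{P}(X_n\cong G)=\mathbb{P}(X\cong G)$ for every finite $\mathfrak{O}$-module $G$. -/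

import Mathlib

open Filter Topology MeasureTheory
open scoped ENNReal

noncomputable section

namespace CLM

/-- The nonzero integers that are not divisible by any prime in `S`. -/
def awayFrom (S : Set Nat.Primes) : Submonoid ℤ where
  carrier := {n | n ≠ 0 ∧ ∀ p ∈ S, ¬ ((p : ℕ) : ℤ) ∣ n}
  one_mem' := ⟨one_ne_zero, fun p _ h =>
    (Nat.prime_iff_prime_int.mp p.2).not_isUnit (isUnit_of_dvd_one h)⟩
  mul_mem' := fun ha hb => ⟨mul_ne_zero ha.1 hb.1, fun p hp h =>
    ((Nat.prime_iff_prime_int.mp p.2).dvd_or_dvd h).elim (ha.2 p hp) (hb.2 p hp)⟩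

theorem awayFrom_le (S : Set Nat.Primes) : awayFrom S ≤ nonZeroDivisors ℤ :=
  fun _ hn => mem_nonZeroDivisors_of_ne_zero hn.1

/-- `ℤ_S`: the localization of `ℤ` at the nonzero integers not divisible by any prime in `S`,
realized inside `ℚ`. -/
abbrev ZS (S : Set Nat.Primes) : Subalgebra ℤ ℚ :=
  Localization.subalgebra.ofField ℚ (awayFrom S) (awayFrom_le S)

section Orders

variable {A : Type*} [Ring A] [Algebra ℚ A] {S : Set Nat.Primes}

/-- A `ℤ_S`-order in `A`: a subring (with the same identity) that is finitely generated as a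
`ℤ_S`-module and spans `A` over `ℚ`. -/
structure IsOrder (O : Subalgebra (ZS S) A) : Prop where
  fg : (Subalgebra.toSubmodule O).FG
  span_eq_top : Submodule.span ℚ (O : Set A) = ⊤

/-- A maximal `ℤ_S`-order in `A`: an order not properly contained in any other order. -/
def IsMaximalOrder (O : Subalgebra (ZS S) A) : Prop :=
  Maximal IsOrder O

/-- An irreducible central idempotent: a nonzero central idempotent that is not the sum of two
nonzero orthogonal central idempotents. -/
structure IsIrreducibleCentralIdempotent (e : A) : Prop where
  idem : IsIdempotentElem e
  central : e ∈ Set.center A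
  ne_zero : e ≠ 0
  irreducible : ∀ f g : A, IsIdempotentElem f → f ∈ Set.center A →
    IsIdempotentElem g → g ∈ Set.center A → f * g = 0 → e = f + g → f = 0 ∨ g = 0

/-- The set of irreducible central idempotents of `A`. -/
def irreducibleCentralIdempotents (A : Type*) [Ring A] [Algebra ℚ A] : Set A :=
  {e | IsIrreducibleCentralIdempotent e}

/-- The subalgebra `O + e O` for a central idempotent `e`. -/
def adjoinIdem (O : Subalgebra (ZS S) A) (e : A) (he : IsIdempotentElem e)
    (hc : e ∈ Set.center A) : Subalgebra (ZS S) A where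
  carrier := {x | ∃ a ∈ O, ∃ b ∈ O, x = a + e * b}
  mul_mem' := by
    rintro x y ⟨a, ha, b, hb, rfl⟩ ⟨c, hcO, d, hd, rfl⟩
    refine ⟨a * c, O.mul_mem ha hcO, a * d + b * c + b * d,
      O.add_mem (O.add_mem (O.mul_mem ha hd) (O.mul_mem hb hcO)) (O.mul_mem hb hd), ?_⟩
    have h : ∀ z, z * e = e * z := fun z => (Set.mem_center_iff.mp hc).comm z |>.eq.symm
    have h1 : a * (e * d) = e * (a * d) := by rw [← mul_assoc, h a, mul_assoc]
    have h2 : e * b * (e * d) = e * (b * d) := by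
      rw [mul_assoc, ← mul_assoc b e d, h b, mul_assoc e b d, ← mul_assoc e e, he.eq]
    rw [add_mul, mul_add, mul_add, h1, h2, mul_add, mul_add, mul_assoc e b c]
    abel
  add_mem' := by
    rintro x y ⟨a, ha, b, hb, rfl⟩ ⟨c, hcO, d, hd, rfl⟩
    exact ⟨a + c, O.add_mem ha hcO, b + d, O.add_mem hb hd, by rw [mul_add]; abel⟩
  algebraMap_mem' := fun r => ⟨_, O.algebraMap_mem r, 0, O.zero_mem, by simp⟩

/-- A maximal order contains every central idempotent of the algebra. -/
theorem IsMaximalOrder.mem_of_central {O : Subalgebra (ZS S) A} (hO : IsMaximalOrder O) {e : A}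
    (he : IsIdempotentElem e) (hc : e ∈ Set.center A) : e ∈ O := by
  have hle : O ≤ adjoinIdem O e he hc := fun a ha => ⟨a, ha, 0, O.zero_mem, by simp⟩
  have hord : IsOrder (adjoinIdem O e he hc) := by
    refine ⟨?_, top_le_iff.mp (hO.prop.span_eq_top.ge.trans (Submodule.span_mono hle))⟩
    have : Subalgebra.toSubmodule (adjoinIdem O e he hc) =
        Subalgebra.toSubmodule O ⊔
          (Subalgebra.toSubmodule O).map (LinearMap.mulLeft (ZS S) e) := by
      ext x
      simp only [Submodule.mem_sup, Submodule.mem_map, Subalgebra.mem_toSubmodule,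
        LinearMap.mulLeft_apply]
      constructor
      · rintro ⟨a, ha, b, hb, rfl⟩
        exact ⟨a, ha, e * b, ⟨b, hb, rfl⟩, rfl⟩
      · rintro ⟨a, ha, _, ⟨b, hb, rfl⟩, rfl⟩
        exact ⟨a, ha, b, hb, rfl⟩
    rw [this]
    exact hO.prop.fg.sup (hO.prop.fg.map _)
  exact hO.le_of_ge hord hle ⟨0, O.zero_mem, 1, O.one_mem, by simp⟩

end Orders

/-- A finite left `R`-module. (Every finite module is isomorphic to one in `Type`.) -/
structure FiniteModule (R : Type*) [Ring R] where
  carrier : Type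
  [addCommGroup : AddCommGroup carrier]
  [module : Module R carrier]
  [finite : Finite carrier]

attribute [instance] FiniteModule.addCommGroup FiniteModule.module FiniteModule.finite

instance (R : Type*) [Ring R] : CoeSort (FiniteModule R) Type := ⟨FiniteModule.carrier⟩

/-- Isomorphism of finite `R`-modules. -/
def Iso {R : Type*} [Ring R] (G H : FiniteModule R) : Prop := Nonempty (G ≃ₗ[R] H)

/-- Isomorphism as an equivalence relation. -/
def isoSetoid (R : Type*) [Ring R] : Setoid (FiniteModule R) where
  r := Iso
  iseqv := ⟨fun _ => ⟨LinearEquiv.refl R _⟩, fun ⟨f⟩ => ⟨f.symm⟩, fun ⟨f⟩ ⟨g⟩ => ⟨f.trans g⟩⟩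

/-- The isomorphism classes of finite `R`-modules. -/
def IsoClass (R : Type*) [Ring R] := Quotient (isoSetoid R)

/-- The isomorphism class of `G`. -/
def isoClass {R : Type*} [Ring R] (G : FiniteModule R) : IsoClass R := Quotient.mk (isoSetoid R) G

/-- A chosen representative of an isomorphism class. -/
def IsoClass.rep {R : Type*} [Ring R] (c : IsoClass R) : FiniteModule R :=
  @Quotient.out _ (isoSetoid R) c

/-- `|Sur_R(G, H)|`. -/
def surCard {R : Type*} [Ring R] (G H : FiniteModule R) : ℕ :=
  Nat.card {f : G →ₗ[R] H // Function.Surjective f}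

/-- `|Aut_R(G)|`. -/
def autCard {R : Type*} [Ring R] (G : FiniteModule R) : ℕ := Nat.card (G ≃ₗ[R] G)

/-- A random finite `R`-module on a measurable space: a map to finite `R`-modules for which every
event `X ≅ G` is measurable. -/
def IsRandomModule {R : Type*} [Ring R] {Ω : Type*} [MeasurableSpace Ω]
    (X : Ω → FiniteModule R) : Prop :=
  ∀ G : FiniteModule R, MeasurableSet {ω | Iso (X ω) G}

section Weights

variable {A : Type*} [Ring A] [Algebra ℚ A] {S : Set Nat.Primes} {O : Subalgebra (ZS S) A}
  (hO : IsMaximalOrder O) {m : ℕ} (e : Fin m ≃ irreducibleCentralIdempotents A) (u : Fin m → ℚ)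

/-- `|G|^u = ∏ i, |e_i G| ^ u_i`, where `e_1, …, e_m` are the irreducible central idempotents. -/
def powU (G : FiniteModule O) : ℝ :=
  ∏ i, (Nat.card (Set.range fun g : G =>
    (⟨(e i : A), hO.mem_of_central (e i).2.idem (e i).2.central⟩ : O) • g) : ℝ) ^ (u i : ℝ)

/-- The sum `Z(u)` of `1 / (|G|^u |Aut G|)` over the isomorphism classes of finite `O`-modules. -/
def Z : ℝ := ∑' c : IsoClass O, 1 / (powU hO e u c.rep * autCard c.rep)

/-- `p` is the law of the Cohen-Lenstra-Martinet random module `X(A, u, O)`. -/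
def IsCohenLenstraMartinet (p : PMF (IsoClass O)) : Prop :=
  ∀ G₁ G₂ : FiniteModule O,
    (p (isoClass G₁)).toReal / (p (isoClass G₂)).toReal =
      (powU hO e u G₂ * autCard G₂) / (powU hO e u G₁ * autCard G₁)

end Weights

end CLM

end

/-!
Over a maximal order `O` every maximal two-sided ideal is invertible, and any two of them commute.
Multiplying a lattice by the annihilator of a simple module `K` therefore scales all indices
uniformly, and `|Hom(N, K)| = |Hom(O^d, K)|` for every submodule `N` of finite index in `O^d`. This
is the only arithmetic input.

It makes the count of extensions of a finite module by a finite module multiplicative. If the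
moments of `X_n` converge to `1 / |G|^u`, then so do, up to a factor depending only on `F`, those of
the kernels of the surjections `X_n → F`. A surjection `X_n → F` is an isomorphism as soon as its
kernel has no simple quotient, and there are only finitely many simple modules, so a sieve over
these turns the moments into `P(X_n ≅ F) → c / (|Aut F| |F|^u)` with `c` independent of `F`.

The moments into simple modules bound the number of generators of `X_n`, and this bound is tight
enough that no mass escapes to infinity: the limits sum to one, whence `c = 1 / Z(u)`.
-/

noncomputable section

namespace CLM

section SimpleModules

variable {R : Type*} [Ring R]

theorem exists_comp_eq_of_ker_le {X Y Z : Type*} [AddCommGroup X] [Module R X] [AddCommGroup Y]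
    [Module R Y] [AddCommGroup Z] [Module R Z] {σ : X →ₗ[R] Y} (hσ : Function.Surjective σ)
    (f : X →ₗ[R] Z) (h : LinearMap.ker σ ≤ LinearMap.ker f) : ∃ g : Y →ₗ[R] Z, g ∘ₗ σ = f := by
  refine ⟨(LinearMap.ker σ).liftQ f h ∘ₗ (σ.quotKerEquivOfSurjective hσ).symm.toLinearMap,
    LinearMap.ext fun x => ?_⟩
  have hx : (σ.quotKerEquivOfSurjective hσ).symm (σ x) = Submodule.Quotient.mk x := by
    rw [LinearEquiv.symm_apply_eq]
    rfl
  simp only [LinearMap.comp_apply, LinearEquiv.coe_coe, hx, Submodule.liftQ_apply]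

theorem exists_comp_eq_of_range_le {X Y Z : Type*} [AddCommGroup X] [Module R X] [AddCommGroup Y]
    [Module R Y] [AddCommGroup Z] [Module R Z] {ι : Y →ₗ[R] Z} (hι : Function.Injective ι)
    (f : X →ₗ[R] Z) (h : LinearMap.range f ≤ LinearMap.range ι) :
    ∃ g : X →ₗ[R] Y, ι ∘ₗ g = f :=
  ⟨(LinearEquiv.ofInjective ι hι).symm.toLinearMap ∘ₗ f.codRestrict _ fun x => h ⟨x, rfl⟩,
    LinearMap.ext fun _ => LinearEquiv.ofInjective_symm_apply ι (h := hι) _⟩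

instance finite_linearMap {X Y : Type*} [AddCommGroup X] [Module R X] [AddCommGroup Y]
    [Module R Y] [Finite X] [Finite Y] : Finite (X →ₗ[R] Y) :=
  Finite.of_injective _ DFunLike.coe_injective

theorem natCard_hom_congr {X Y M : Type*} [AddCommGroup X] [Module R X] [AddCommGroup Y]
    [Module R Y] [AddCommGroup M] [Module R M] (e : X ≃ₗ[R] Y) :
    Nat.card (X →ₗ[R] M) = Nat.card (Y →ₗ[R] M) :=
  Nat.card_congr (LinearEquiv.congrLeft M ℕ e).toEquiv

theorem natCard_hom_quotient {N K : Type*} [AddCommGroup N] [Module R N] [AddCommGroup K]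
    [Module R K] (N' : Submodule R N) (h : ∀ f : N →ₗ[R] K, N' ≤ LinearMap.ker f) :
    Nat.card (N ⧸ N' →ₗ[R] K) = Nat.card (N →ₗ[R] K) :=
  Nat.card_congr
    { toFun := fun f => f ∘ₗ N'.mkQ
      invFun := fun f => N'.liftQ f (h f)
      left_inv := fun f => by ext; simp
      right_inv := fun f => by ext; simp }

variable {K : Type*} [AddCommGroup K] [Module R K]

theorem isIsotypicOfType_pi [IsSimpleModule R K] (ι : Type*) :
    IsIsotypicOfType R (ι → K) K := by
  intro N _
  have := IsSimpleModule.nontrivial R N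
  obtain ⟨x, hx⟩ := exists_ne (0 : N)
  obtain ⟨i, hi⟩ := Function.ne_iff.mp (Subtype.coe_ne_coe.mpr hx)
  have hproj : LinearMap.proj i ∘ₗ N.subtype ≠ 0 := fun h => hi (LinearMap.congr_fun h x)
  exact ⟨LinearEquiv.ofBijective _ (LinearMap.bijective_of_ne_zero hproj)⟩

/- The homotheties of `K` embed `R ⧸ ann K` into a finite power of `K`, and a finitely generated
module killed by `ann K` is a quotient of a finite power of `R ⧸ ann K`. -/
theorem exists_injective_pi_of_annihilator_le [IsSimpleModule R K] [Finite K] {Y : Type*}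
    [AddCommGroup Y] [Module R Y] [Module.Finite R Y]
    (h : Module.annihilator R K ≤ Module.annihilator R Y) :
    ∃ (n : ℕ) (f : Y →ₗ[R] (Fin n × K → K)), Function.Injective f := by
  obtain ⟨n, σ, hσ⟩ := Module.Finite.exists_fin' R Y
  let homotheties : (Fin n → R) →ₗ[R] (Fin n × K → K) :=
    LinearMap.pi fun p => LinearMap.toSpanSingleton R K p.2 ∘ₗ LinearMap.proj p.1
  have hker : LinearMap.ker homotheties.rangeRestrict ≤ LinearMap.ker σ := by
    intro r hr
    rw [LinearMap.ker_rangeRestrict] at hr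
    have hann (i : Fin n) : r i ∈ Module.annihilator R Y :=
      h (Module.mem_annihilator.mpr fun k => congrFun hr (i, k))
    rw [LinearMap.mem_ker, LinearMap.pi_apply_eq_sum_univ]
    exact Finset.sum_eq_zero fun i _ => Module.mem_annihilator.mp (hann i) _
  obtain ⟨g, hg⟩ := exists_comp_eq_of_ker_le homotheties.surjective_rangeRestrict σ hker
  have hg_surj : Function.Surjective g := by
    refine Function.Surjective.of_comp (g := homotheties.rangeRestrict) ?_
    rwa [← LinearMap.coe_comp, hg]
  obtain ⟨s, hs⟩ := IsSemisimpleModule.lifting_property g hg_surj LinearMap.id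
  exact ⟨n, (LinearMap.range homotheties).subtype ∘ₗ s,
    Subtype.val_injective.comp (Function.LeftInverse.injective (LinearMap.congr_fun hs))⟩

theorem exists_linearEquiv_fun_of_annihilator_le [IsSimpleModule R K] [Finite K] {Y : Type*}
    [AddCommGroup Y] [Module R Y] [Module.Finite R Y]
    (h : Module.annihilator R K ≤ Module.annihilator R Y) :
    ∃ n : ℕ, Nonempty (Y ≃ₗ[R] Fin n → K) := by
  obtain ⟨n, f, hf⟩ := exists_injective_pi_of_annihilator_le h
  have : IsSemisimpleModule R Y := .of_injective f hf
  exact ((isIsotypicOfType_pi (Fin n × K)).of_injective f hf).linearEquiv_fun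

theorem nonempty_linearEquiv_of_annihilator_le [IsSimpleModule R K] [Finite K] {K' : Type*}
    [AddCommGroup K'] [Module R K'] [IsSimpleModule R K']
    (h : Module.annihilator R K ≤ Module.annihilator R K') : Nonempty (K' ≃ₗ[R] K) := by
  obtain ⟨n, f, hf⟩ := exists_injective_pi_of_annihilator_le h
  have : IsSimpleModule R (⊤ : Submodule R K') := .congr Submodule.topEquiv
  obtain ⟨g⟩ := (isIsotypicOfType_pi (Fin n × K)).of_injective f hf ⊤
  exact ⟨Submodule.topEquiv.symm.trans g⟩

theorem natCard_hom_eq_of_natCard_eq [IsSimpleModule R K] [Finite K] {Y Y' : Type*}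
    [AddCommGroup Y] [Module R Y] [Module.Finite R Y] [AddCommGroup Y'] [Module R Y']
    [Module.Finite R Y'] (h : Module.annihilator R K ≤ Module.annihilator R Y)
    (h' : Module.annihilator R K ≤ Module.annihilator R Y') (hcard : Nat.card Y = Nat.card Y') :
    Nat.card (Y →ₗ[R] K) = Nat.card (Y' →ₗ[R] K) := by
  obtain ⟨n, ⟨f⟩⟩ := exists_linearEquiv_fun_of_annihilator_le h
  obtain ⟨n', ⟨f'⟩⟩ := exists_linearEquiv_fun_of_annihilator_le h'
  have := IsSimpleModule.nontrivial R K
  obtain rfl : n = n' := by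
    refine Nat.pow_right_injective (Finite.one_lt_card (α := K)) ?_
    simpa only [Nat.card_congr f.toEquiv, Nat.card_congr f'.toEquiv, Nat.card_fun, Nat.card_fin]
      using hcard
  rw [natCard_hom_congr f, natCard_hom_congr f']

theorem one_lt_natCard_end [IsSimpleModule R K] [Finite K] : 1 < Nat.card (Module.End R K) := by
  have := IsSimpleModule.nontrivial R K
  exact Finite.one_lt_card

theorem exists_natCard_hom_eq_pow [IsSimpleModule R K] [Finite K] {X : Type*} [AddCommGroup X]
    [Module R X] [Finite X] :
    ∃ r : ℕ, Nat.card (X →ₗ[R] K) = Nat.card (Module.End R K) ^ r := by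
  classical
  exact ⟨_, Module.natCard_eq_pow_finrank (K := Module.End R K) (V := X →ₗ[R] K)⟩

end SimpleModules

section Finiteness

/- Every unit of `B` that is an integer is already invertible in the finite image of `ℤ`. -/
theorem finite_of_intCast_eq_zero {B : Type*} [CommRing B] {a : ℤ} (ha : a ≠ 0)
    (ha0 : (a : B) = 0) (h : ∀ y : B, ∃ n s : ℤ, IsUnit (s : B) ∧ y * s = n) : Finite B := by
  have hfin : Finite (Int.castRingHom B).range := by
    refine ((Set.finite_Icc 0 |a|).image (Int.castRingHom B)).subset ?_
    rintro _ ⟨n, rfl⟩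
    refine ⟨n % a, ⟨Int.emod_nonneg _ ha, (Int.emod_lt_abs _ ha).le⟩, ?_⟩
    simpa [ha0] using congrArg (Int.cast (R := B)) (Int.emod_add_mul_ediv n a)
  refine Finite.of_surjective (Int.castRingHom B).range.subtype fun y => ?_
  obtain ⟨n, s, hs, hys⟩ := h y
  let s' : (Int.castRingHom B).range := ⟨s, s, rfl⟩
  have hs' : IsUnit s' := by
    rw [isUnit_iff_mem_nonZeroDivisors_of_finite, mem_nonZeroDivisors_iff_right]
    intro x hx
    exact Subtype.ext (hs.mul_left_eq_zero.mp (congrArg Subtype.val hx))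
  obtain ⟨⟨_, k, rfl⟩, hk⟩ := hs'.exists_right_inv
  have hsk : (s : B) * k = 1 := congrArg Subtype.val hk
  exact ⟨⟨n * k, n * k, by simp⟩, by simp [← hys, mul_assoc, hsk]⟩

instance isNoetherianRing_ZS (S : Set Nat.Primes) : IsNoetherianRing (ZS S) :=
  have := Localization.subalgebra.isLocalization_ofField ℚ (awayFrom S) (awayFrom_le S)
  IsLocalization.isNoetherianRing (awayFrom S) _ inferInstance

theorem isUnit_intCast_of_mem_awayFrom {S : Set Nat.Primes} {s : ℤ} (hs : s ∈ awayFrom S) :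
    IsUnit (s : ZS S) := by
  have := Localization.subalgebra.isLocalization_ofField ℚ (awayFrom S) (awayFrom_le S)
  simpa using IsLocalization.map_units (ZS S) (⟨s, hs⟩ : awayFrom S)

theorem finite_quotient_span_intCast (S : Set Nat.Primes) {a : ℤ} (ha : a ≠ 0) :
    Finite (ZS S ⧸ Ideal.span {(a : ZS S)}) := by
  have := Localization.subalgebra.isLocalization_ofField ℚ (awayFrom S) (awayFrom_le S)
  let π := Ideal.Quotient.mk (Ideal.span {(a : ZS S)})
  have ha0 : π a = 0 := Ideal.Quotient.eq_zero_iff_mem.mpr (Ideal.mem_span_singleton_self _)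
  refine finite_of_intCast_eq_zero ha ((map_intCast π a).symm.trans ha0) fun y => ?_
  obtain ⟨x, rfl⟩ := Ideal.Quotient.mk_surjective y
  obtain ⟨⟨n, s⟩, hx⟩ := IsLocalization.surj (awayFrom S) x
  refine ⟨n, s, ?_, ?_⟩
  · simpa using (isUnit_intCast_of_mem_awayFrom s.2).map π
  · simpa [π] using (map_mul π x s).symm.trans (congrArg π hx)

theorem finite_of_finite_quotient_span {R : Type*} [CommRing R] (a : R)
    [Finite (R ⧸ Ideal.span {a})] {M : Type*} [AddCommGroup M] [Module R M] [Module.Finite R M]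
    (h : ∀ x : M, a • x = 0) : Finite M := by
  have htors : Module.IsTorsionBySet R M (Ideal.span {a}) :=
    (Module.isTorsionBySet_span_singleton_iff a).mpr h
  let _ : Module (R ⧸ Ideal.span {a}) M := htors.module
  have : IsScalarTower R (R ⧸ Ideal.span {a}) M := htors.isScalarTower
  have : Module.Finite (R ⧸ Ideal.span {a}) M := .of_restrictScalars_finite R _ M
  exact Module.finite_of_finite (R ⧸ Ideal.span {a})

theorem finite_of_zsmul_eq_zero {R A : Type*} [CommRing R] [Ring A] [Algebra R A]
    [Module.Finite R A] {n : ℤ} [Finite (R ⧸ Ideal.span {(n : R)})] {Y : Type*} [AddCommGroup Y]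
    [Module A Y] [Module.Finite A Y] (h : ∀ y : Y, n • y = 0) : Finite Y := by
  let _ : Module R Y := Module.compHom Y (algebraMap R A)
  have : IsScalarTower R A Y := .of_algebraMap_smul fun _ _ => rfl
  have : Module.Finite R Y := Module.Finite.trans A Y
  refine finite_of_finite_quotient_span (n : R) fun y => ?_
  rw [Int.cast_smul_eq_zsmul, h]

end Finiteness

section TwoSidedIdeals

variable {R A : Type*} [CommRing R] [Ring A] [Algebra R A] {O : Subalgebra R A}

local notation "𝒪" => Subalgebra.toSubmodule O

variable (O) in
/-- A subset of the ambient algebra `A` that is an `O`-`O`-bimodule; it need not lie in `O`. -/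
structure IsSubbimodule (B : Submodule R A) : Prop where
  left : 𝒪 * B ≤ B
  right : B * 𝒪 ≤ B

variable (O) in
/-- A two-sided ideal of `O` of finite index, for the orders considered here: the condition on the
index is encoded by the existence of a nonzero integer in the ideal. -/
structure IsFullIdeal (B : Submodule R A) : Prop extends IsSubbimodule O B where
  le : B ≤ 𝒪
  exists_int : ∃ n : ℤ, n ≠ 0 ∧ (n : A) ∈ B

variable (O) in
/-- A maximal element among the full ideals of `O` different from `O`. -/
structure IsMaxIdeal (P : Submodule R A) : Prop extends IsFullIdeal O P where
  ne : P ≠ 𝒪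
  eq_or_eq : ∀ B, IsFullIdeal O B → P ≤ B → B = P ∨ B = 𝒪

variable {B C P Q : Submodule R A}

namespace IsSubbimodule

theorem left_eq (h : IsSubbimodule O B) : 𝒪 * B = B :=
  le_antisymm h.left fun b hb => by
    simpa using Submodule.mul_mem_mul (show (1 : A) ∈ 𝒪 from O.one_mem) hb

theorem right_eq (h : IsSubbimodule O B) : B * 𝒪 = B :=
  le_antisymm h.right fun b hb => by
    simpa using Submodule.mul_mem_mul hb (show (1 : A) ∈ 𝒪 from O.one_mem)

theorem self : IsSubbimodule O 𝒪 :=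
  have h := (Subalgebra.isIdempotentElem_toSubmodule O).eq.le
  ⟨h, h⟩

theorem mul (hB : IsSubbimodule O B) (hC : IsSubbimodule O C) : IsSubbimodule O (B * C) :=
  ⟨by rw [← mul_assoc, hB.left_eq], by rw [mul_assoc, hC.right_eq]⟩

theorem inf (hB : IsSubbimodule O B) (hC : IsSubbimodule O C) : IsSubbimodule O (B ⊓ C) where
  left := le_inf ((mul_le_mul_right inf_le_left _).trans hB.left)
    ((mul_le_mul_right inf_le_right _).trans hC.left)
  right := le_inf ((mul_le_mul_left inf_le_left _).trans hB.right)
    ((mul_le_mul_left inf_le_right _).trans hC.right)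

theorem sup (hB : IsSubbimodule O B) (hC : IsSubbimodule O C) : IsSubbimodule O (B ⊔ C) :=
  ⟨by rw [Submodule.mul_sup, hB.left_eq, hC.left_eq],
    by rw [Submodule.sup_mul, hB.right_eq, hC.right_eq]⟩

end IsSubbimodule

namespace IsFullIdeal

theorem of_le (hB : IsFullIdeal O B) (hBC : B ≤ C) (hC : C ≤ 𝒪) (h : IsSubbimodule O C) :
    IsFullIdeal O C :=
  ⟨h, hC, hB.exists_int.imp fun _ hn => ⟨hn.1, hBC hn.2⟩⟩

theorem self : IsFullIdeal O 𝒪 := ⟨.self, le_rfl, 1, one_ne_zero, by simp⟩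

theorem mul_le_left (hB : IsFullIdeal O B) (hC : IsFullIdeal O C) : B * C ≤ B :=
  (mul_le_mul_right hC.le B).trans hB.right

theorem mul_le_right (hB : IsFullIdeal O B) (hC : IsFullIdeal O C) : B * C ≤ C :=
  (mul_le_mul_left hB.le C).trans hC.left

theorem mul (hB : IsFullIdeal O B) (hC : IsFullIdeal O C) : IsFullIdeal O (B * C) where
  toIsSubbimodule := hB.toIsSubbimodule.mul hC.toIsSubbimodule
  le := (hB.mul_le_left hC).trans hB.le
  exists_int := by
    obtain ⟨n, hn, hnB⟩ := hB.exists_int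
    obtain ⟨k, hk, hkC⟩ := hC.exists_int
    exact ⟨n * k, mul_ne_zero hn hk, by push_cast; exact Submodule.mul_mem_mul hnB hkC⟩

theorem inf (hB : IsFullIdeal O B) (hC : IsFullIdeal O C) : IsFullIdeal O (B ⊓ C) :=
  (hB.mul hC).of_le (le_inf (hB.mul_le_left hC) (hB.mul_le_right hC)) (inf_le_left.trans hB.le)
    (hB.toIsSubbimodule.inf hC.toIsSubbimodule)

theorem sup (hB : IsFullIdeal O B) (hC : IsFullIdeal O C) : IsFullIdeal O (B ⊔ C) :=
  hB.of_le le_sup_left (sup_le hB.le hC.le) (hB.toIsSubbimodule.sup hC.toIsSubbimodule)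

end IsFullIdeal

theorem IsMaxIdeal.le_or_le_of_mul_le (hP : IsMaxIdeal O P) (hB : IsFullIdeal O B)
    (hC : IsFullIdeal O C) (h : B * C ≤ P) : B ≤ P ∨ C ≤ P := by
  rcases hP.eq_or_eq _ (hP.toIsFullIdeal.sup hB) le_sup_left with hPB | hPB
  · exact Or.inl (sup_eq_left.mp hPB)
  · right
    calc C = P * C ⊔ B * C := by rw [← Submodule.sup_mul, hPB, hC.left_eq]
      _ ≤ P := sup_le (hP.toIsFullIdeal.mul_le_left hC) h

variable (O) in
/-- The product of a list of ideals of `O`; the empty product is `O`, not the unit of the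
semiring of submodules. -/
def idealProd (l : List (Submodule R A)) : Submodule R A := l.foldr (· * ·) 𝒪

@[simp] theorem idealProd_nil : idealProd O [] = 𝒪 := rfl

@[simp] theorem idealProd_cons (P : Submodule R A) (l : List (Submodule R A)) :
    idealProd O (P :: l) = P * idealProd O l := rfl

theorem isFullIdeal_idealProd {l : List (Submodule R A)} (h : ∀ P ∈ l, IsFullIdeal O P) :
    IsFullIdeal O (idealProd O l) := by
  induction l with
  | nil => exact IsFullIdeal.self
  | cons P l ih =>
    rw [List.forall_mem_cons] at h
    exact h.1.mul (ih h.2)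

theorem idealProd_append {l l' : List (Submodule R A)} (h : ∀ P ∈ l', IsFullIdeal O P) :
    idealProd O (l ++ l') = idealProd O l * idealProd O l' := by
  induction l with
  | nil => simp [(isFullIdeal_idealProd h).left_eq]
  | cons P l ih => simp [ih, mul_assoc]

theorem IsMaxIdeal.mem_of_idealProd_le (hP : IsMaxIdeal O P) {l : List (Submodule R A)}
    (h : ∀ Q ∈ l, IsMaxIdeal O Q) (hl : idealProd O l ≤ P) : P ∈ l := by
  induction l with
  | nil => exact absurd (le_antisymm hP.le hl) hP.ne
  | cons Q l ih =>
    rw [List.forall_mem_cons] at h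
    have hfull := isFullIdeal_idealProd fun J hJ => (h.2 J hJ).toIsFullIdeal
    rcases hP.le_or_le_of_mul_le h.1.toIsFullIdeal hfull hl with hQP | hlP
    · have hPQ : P = Q := (h.1.eq_or_eq P hP.toIsFullIdeal hQP).resolve_right hP.ne
      exact hPQ ▸ List.mem_cons_self
    · exact List.mem_cons_of_mem _ (ih h.2 hlP)

end TwoSidedIdeals

section Annihilators

variable {R A : Type*} [CommRing R] [Ring A] [Algebra R A] {O : Subalgebra R A}

local notation "𝒪" => Subalgebra.toSubmodule O

variable (O) in
/-- The annihilator of an `O`-module, as a subset of the ambient algebra, so that it can be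
multiplied with ideals and fractional ideals of `O`. -/
def annIdeal (K : Type*) [AddCommGroup K] [Module O K] : Submodule R A :=
  ((Module.annihilator O K).restrictScalars R).map O.val.toLinearMap

variable {K : Type*} [AddCommGroup K] [Module O K]

theorem coe_mem_annIdeal {x : O} : (x : A) ∈ annIdeal O K ↔ x ∈ Module.annihilator O K := by
  simp [annIdeal]

theorem isSubbimodule_annIdeal : IsSubbimodule O (annIdeal O K) where
  left := by
    rw [Submodule.mul_le]
    rintro r hr _ ⟨y, hy, rfl⟩
    exact coe_mem_annIdeal.mpr (Ideal.mul_mem_left _ (⟨r, hr⟩ : O) hy)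
  right := by
    rw [Submodule.mul_le]
    rintro _ ⟨y, hy, rfl⟩ r hr
    exact coe_mem_annIdeal.mpr (Ideal.mul_mem_right (⟨r, hr⟩ : O) _ hy)

theorem isFullIdeal_annIdeal [Finite K] : IsFullIdeal O (annIdeal O K) where
  toIsSubbimodule := isSubbimodule_annIdeal
  le := by
    rintro _ ⟨y, -, rfl⟩
    exact y.2
  exists_int := by
    refine ⟨Nat.card K, Nat.cast_ne_zero.mpr Nat.card_pos.ne', ?_⟩
    have : ((Nat.card K : O) : A) ∈ annIdeal O K := coe_mem_annIdeal.mpr <|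
      Module.mem_annihilator.mpr fun k => by rw [Nat.cast_smul_eq_nsmul, card_nsmul_eq_zero']
    simpa using this

theorem annIdeal_ne_top [Nontrivial K] : annIdeal O K ≠ 𝒪 := by
  intro h
  obtain ⟨k, hk⟩ := exists_ne (0 : K)
  have h1 : (1 : O) ∈ Module.annihilator O K :=
    coe_mem_annIdeal.mp (h ▸ (1 : O).2)
  exact hk (by simpa using Module.mem_annihilator.mp h1 k)

theorem exists_isSimpleModule_le_annIdeal {B : Submodule R A} (hB : IsSubbimodule O B)
    (hBO : B ≤ 𝒪) (hne : B ≠ 𝒪) :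
    ∃ m : Ideal O, IsSimpleModule O (O ⧸ m) ∧ B ≤ annIdeal O (O ⧸ m) := by
  let I : Ideal O :=
    { carrier := {x | (x : A) ∈ B}
      add_mem' := B.add_mem
      zero_mem' := B.zero_mem
      smul_mem' := fun c _ hx => hB.left (Submodule.mul_mem_mul c.2 hx) }
  have hI : I ≠ ⊤ := fun h => hne <| le_antisymm hBO fun x hx =>
    show (⟨x, hx⟩ : O) ∈ I from h ▸ Submodule.mem_top
  obtain ⟨m, hm, hIm⟩ := Ideal.exists_le_maximal I hI
  refine ⟨m, isSimpleModule_iff_isCoatom.mpr hm.out, fun b hb => ?_⟩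
  refine (coe_mem_annIdeal (x := ⟨b, hBO hb⟩)).mpr (Module.mem_annihilator.mpr fun y => ?_)
  obtain ⟨r, rfl⟩ := Submodule.Quotient.mk_surjective _ y
  rw [← Submodule.Quotient.mk_smul, Submodule.Quotient.mk_eq_zero]
  exact hIm (hB.right (Submodule.mul_mem_mul hb r.2))

theorem isMaxIdeal_annIdeal [Finite K] [IsSimpleModule O K] : IsMaxIdeal O (annIdeal O K) where
  toIsFullIdeal := isFullIdeal_annIdeal
  ne := have := IsSimpleModule.nontrivial O K; annIdeal_ne_top
  eq_or_eq B hB hle := by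
    refine or_iff_not_imp_right.mpr fun hne => le_antisymm ?_ hle
    obtain ⟨m, _, hBm⟩ := exists_isSimpleModule_le_annIdeal hB.toIsSubbimodule hB.le hne
    obtain ⟨f⟩ := nonempty_linearEquiv_of_annihilator_le (K := K) (K' := O ⧸ m) fun x hx =>
      coe_mem_annIdeal.mp (hBm (hle (coe_mem_annIdeal.mpr hx)))
    rwa [annIdeal, f.annihilator_eq] at hBm

theorem annIdeal_mul_annIdeal_quotient_le (m : Submodule O K) :
    annIdeal O m * annIdeal O (K ⧸ m) ≤ annIdeal O K := by
  rw [Submodule.mul_le]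
  rintro _ ⟨x, hx, rfl⟩ _ ⟨y, hy, rfl⟩
  refine (coe_mem_annIdeal (x := x * y)).mpr (Module.mem_annihilator.mpr fun k => ?_)
  have hyk : y • k ∈ m := by
    rw [← Submodule.Quotient.mk_eq_zero, Submodule.Quotient.mk_smul]
    exact Module.mem_annihilator.mp hy _
  rw [mul_smul]
  exact congrArg Subtype.val (Module.mem_annihilator.mp hx (⟨_, hyk⟩ : m))

theorem exists_idealProd_le_annIdeal (Y : Type*) [AddCommGroup Y] [Module O Y] [Finite Y] :
    ∃ l : List (Submodule R A), (∀ P ∈ l, IsMaxIdeal O P) ∧ idealProd O l ≤ annIdeal O Y := by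
  induction h : Nat.card Y using Nat.strong_induction_on generalizing Y with
  | _ n ih =>
    rcases subsingleton_or_nontrivial Y with hY | hY
    · exact ⟨[], by simp, fun x hx => coe_mem_annIdeal (x := ⟨x, hx⟩).mpr
        (Module.mem_annihilator.mpr fun y => Subsingleton.elim _ _)⟩
    obtain ⟨m, hm⟩ := IsCoatomic.exists_coatom (Submodule O Y)
    obtain ⟨x, -, hx⟩ := SetLike.exists_of_lt hm.lt_top
    obtain ⟨l, hl, hle⟩ := ih _ (h ▸ Finite.card_subtype_lt hx) m rfl
    have : IsSimpleModule O (Y ⧸ m) := isSimpleModule_iff_isCoatom.mpr hm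
    have : Finite (Y ⧸ m) := .of_surjective _ m.mkQ_surjective
    have hmax : IsMaxIdeal O (annIdeal O (Y ⧸ m)) := isMaxIdeal_annIdeal
    refine ⟨l ++ [annIdeal O (Y ⧸ m)], ?_, ?_⟩
    · rw [List.forall_mem_append, List.forall_mem_singleton]
      exact ⟨hl, hmax⟩
    · rw [idealProd_append (List.forall_mem_singleton.mpr hmax.toIsFullIdeal), idealProd_cons,
        idealProd_nil, hmax.right_eq]
      exact (mul_le_mul_left hle _).trans (annIdeal_mul_annIdeal_quotient_le m)

end Annihilators

section InvertibleIdeals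

variable {R A : Type*} [CommRing R] [Ring A] [Algebra R A] {O : Subalgebra R A}
  {P Q : Submodule R A}

local notation "𝒪" => Subalgebra.toSubmodule O

variable (O) in
/-- A subset `P` of `A` that has an inverse among the `O`-`O`-bimodules in `A`. -/
def IsInvertible (P : Submodule R A) : Prop :=
  ∃ D, IsSubbimodule O D ∧ P * D = 𝒪 ∧ D * P = 𝒪

variable (O) in
/-- The arithmetic property of a maximal order that the counting of homomorphisms relies on. -/
def MaxIdealsInvertible : Prop := ∀ P, IsMaxIdeal O P → IsInvertible O P

theorem IsMaxIdeal.mul_eq_inf (hP : IsMaxIdeal O P) (hQ : IsMaxIdeal O Q) (hne : P ≠ Q)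
    (hinv : IsInvertible O P) : P * Q = P ⊓ Q := by
  have hPf := hP.toIsFullIdeal
  have hQf := hQ.toIsFullIdeal
  refine le_antisymm (le_inf (hPf.mul_le_left hQf) (hPf.mul_le_right hQf)) ?_
  obtain ⟨D, hD, hPD, hDP⟩ := hinv
  have hOD : 𝒪 ≤ D := hDP.ge.trans ((mul_le_mul_right hP.le D).trans hD.right)
  have hinf := hPf.inf hQf
  have hmul : P * (D * (P ⊓ Q)) = P ⊓ Q := by rw [← mul_assoc, hPD, hinf.left_eq]
  have hfull : IsFullIdeal O (D * (P ⊓ Q)) :=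
    hinf.of_le (hinf.left_eq.ge.trans (mul_le_mul_left hOD _))
      ((mul_le_mul_right inf_le_left _).trans hDP.le) (hD.mul hinf.toIsSubbimodule)
  have hDQ : D * (P ⊓ Q) ≤ Q :=
    (hQ.le_or_le_of_mul_le hPf hfull (hmul.le.trans inf_le_right)).resolve_left fun h =>
      (hP.eq_or_eq _ hQf h).elim (fun h => hne h.symm) hQ.ne
  exact hmul.ge.trans (mul_le_mul_right hDQ P)

theorem IsMaxIdeal.mul_comm (hP : IsMaxIdeal O P) (hQ : IsMaxIdeal O Q)
    (hPinv : IsInvertible O P) (hQinv : IsInvertible O Q) : P * Q = Q * P := by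
  rcases eq_or_ne P Q with rfl | hne
  · rfl
  · rw [hP.mul_eq_inf hQ hne hPinv, hQ.mul_eq_inf hP hne.symm hQinv, inf_comm]

end InvertibleIdeals

section MaximalOrders

open scoped Pointwise

variable {A : Type*} [Ring A] [Algebra ℚ A] {S : Set Nat.Primes} {O : Subalgebra (ZS S) A}

local notation "𝒪" => Subalgebra.toSubmodule O

/-- The multipliers `x` with `x B ⊆ B`, an enlargement of `O` for every left `O`-submodule `B`. -/
def leftOrder (B : Submodule (ZS S) A) : Subalgebra (ZS S) A where
  carrier := {x | ∀ b ∈ B, x * b ∈ B}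
  mul_mem' {x y} hx hy b hb := by rw [mul_assoc]; exact hx _ (hy _ hb)
  add_mem' {x y} hx hy b hb := by rw [add_mul]; exact B.add_mem (hx _ hb) (hy _ hb)
  algebraMap_mem' r b hb := by rw [← Algebra.smul_def]; exact B.smul_mem _ hb

/-- The multipliers `x` with `B x ⊆ B`, an enlargement of `O` for every right `O`-submodule `B`. -/
def rightOrder (B : Submodule (ZS S) A) : Subalgebra (ZS S) A where
  carrier := {x | ∀ b ∈ B, b * x ∈ B}
  mul_mem' {x y} hx hy b hb := by rw [← mul_assoc]; exact hy _ (hx _ hb)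
  add_mem' {x y} hx hy b hb := by rw [mul_add]; exact B.add_mem (hx _ hb) (hy _ hb)
  algebraMap_mem' r b hb := by
    rw [← Algebra.commutes, ← Algebra.smul_def]; exact B.smul_mem _ hb

theorem IsOrder.of_zsmul_mem (hO : IsOrder O) {L : Subalgebra (ZS S) A} (hL : O ≤ L) {n : ℤ}
    (hn : n ≠ 0) (h : ∀ x ∈ L, n • x ∈ O) : IsOrder L := by
  refine ⟨?_, top_le_iff.mp (hO.span_eq_top.ge.trans (Submodule.span_mono hL))⟩
  let div : A →ₗ[ZS S] A := LinearMap.lsmul ℚ A (n : ℚ)⁻¹ |>.restrictScalars (ZS S)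
  have hle : Subalgebra.toSubmodule L ≤ (𝒪).map div := fun x hx =>
    ⟨n • x, h x hx, by simp [div, ← Int.cast_smul_eq_zsmul ℚ, hn]⟩
  exact isNoetherian_submodule.mp
    (isNoetherian_of_fg_of_noetherian _ (hO.fg.map div)) _ hle

variable {B P X : Submodule (ZS S) A}

namespace IsMaximalOrder

theorem le_of_mul_le_left (hO : IsMaximalOrder O) (hB : IsFullIdeal O B) (h : X * B ≤ B) :
    X ≤ 𝒪 := by
  have hOL : O ≤ leftOrder B := fun x hx b hb => hB.left (Submodule.mul_mem_mul hx hb)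
  obtain ⟨n, hn, hnB⟩ := hB.exists_int
  have hL : IsOrder (leftOrder B) := hO.prop.of_zsmul_mem hOL hn fun x hx => by
    rw [zsmul_eq_mul, Int.cast_comm]
    exact hB.le (hx _ hnB)
  exact fun x hx => hO.le_of_ge hL hOL fun b hb => h (Submodule.mul_mem_mul hx hb)

theorem le_of_mul_le_right (hO : IsMaximalOrder O) (hB : IsFullIdeal O B) (h : B * X ≤ B) :
    X ≤ 𝒪 := by
  have hOR : O ≤ rightOrder B := fun x hx b hb => hB.right (Submodule.mul_mem_mul hb hx)
  obtain ⟨n, hn, hnB⟩ := hB.exists_int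
  have hR : IsOrder (rightOrder B) := hO.prop.of_zsmul_mem hOR hn fun x hx => by
    rw [zsmul_eq_mul]
    exact hB.le (hx _ hnB)
  exact fun x hx => hO.le_of_ge hR hOR fun b hb => h (Submodule.mul_mem_mul hb hx)

end IsMaximalOrder

theorem IsFullIdeal.smul_le (hP : IsFullIdeal O P) {n : ℤ} (hn : (n : A) ∈ P) :
    (n : ℚ) • 𝒪 ≤ P := by
  rintro _ ⟨x, hx, rfl⟩
  simpa [Int.cast_smul_eq_zsmul] using hP.right (Submodule.mul_mem_mul hn hx)

theorem exists_idealProd_le_smul (hO : IsOrder O) {n : ℤ} (hn : n ≠ 0) :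
    ∃ l : List (Submodule (ZS S) A), (∀ P ∈ l, IsMaxIdeal O P) ∧
      idealProd O l ≤ (n : ℚ) • 𝒪 := by
  have := finite_quotient_span_intCast S hn
  have : Module.Finite (ZS S) O := Module.Finite.iff_fg.mpr hO.fg
  have : Finite (O ⧸ Ideal.span {(n : O)}) := finite_of_zsmul_eq_zero (n := n) (R := ZS S) (A := O)
    fun x => by
    obtain ⟨y, rfl⟩ := Submodule.Quotient.mk_surjective _ x
    rw [← Submodule.Quotient.mk_smul, Submodule.Quotient.mk_eq_zero, zsmul_eq_mul, Int.cast_comm]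
    exact Ideal.mul_mem_left _ _ (Ideal.mem_span_singleton_self _)
  obtain ⟨l, hl, hle⟩ := exists_idealProd_le_annIdeal (O := O) (O ⧸ Ideal.span {(n : O)})
  refine ⟨l, hl, hle.trans ?_⟩
  rintro _ ⟨y, hy, rfl⟩
  have hy1 := Module.mem_annihilator.mp hy (Submodule.Quotient.mk 1)
  rw [← Submodule.Quotient.mk_smul, Submodule.Quotient.mk_eq_zero, smul_eq_mul, mul_one] at hy1
  obtain ⟨z, rfl⟩ := Ideal.mem_span_singleton'.mp hy1
  refine ⟨z, z.2, ?_⟩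
  simp [Int.cast_smul_eq_zsmul, ← Int.cast_comm]

namespace IsMaxIdeal

-- Cut a shortest product of maximal ideals inside `n O` at a factor `P`.
theorem exists_mul_mul_le_smul (hO : IsOrder O) (hP : IsMaxIdeal O P) {n : ℤ} (hn : n ≠ 0)
    (hnP : (n : A) ∈ P) : ∃ B C, IsFullIdeal O B ∧ IsFullIdeal O C ∧
      B * (P * C) ≤ (n : ℚ) • 𝒪 ∧ ¬ C * B ≤ (n : ℚ) • 𝒪 := by
  obtain ⟨l, ⟨hl, hle⟩, hmin⟩ := exists_minimalFor_of_wellFoundedLT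
    (fun l => (∀ Q ∈ l, IsMaxIdeal O Q) ∧ idealProd O l ≤ (n : ℚ) • 𝒪) List.length
    (exists_idealProd_le_smul hO hn)
  obtain ⟨l₁, l₂, rfl⟩ := List.append_of_mem <|
    hP.mem_of_idealProd_le hl (hle.trans (hP.toIsFullIdeal.smul_le hnP))
  simp only [List.forall_mem_append, List.forall_mem_cons] at hl
  obtain ⟨hl₁, -, hl₂⟩ := hl
  have hfull₁ : ∀ Q ∈ l₁, IsFullIdeal O Q := fun Q hQ => (hl₁ Q hQ).toIsFullIdeal
  have hfull₂ : ∀ Q ∈ l₂, IsFullIdeal O Q := fun Q hQ => (hl₂ Q hQ).toIsFullIdeal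
  refine ⟨idealProd O l₁, idealProd O l₂, isFullIdeal_idealProd hfull₁,
    isFullIdeal_idealProd hfull₂, ?_, fun h => ?_⟩
  · rwa [idealProd_append (List.forall_mem_cons.mpr ⟨hP.toIsFullIdeal, hfull₂⟩)] at hle
  · have hlen := hmin (j := l₂ ++ l₁)
      ⟨List.forall_mem_append.mpr ⟨hl₂, hl₁⟩, by rwa [idealProd_append hfull₁]⟩
    simp only [List.length_append, List.length_cons] at hlen
    lia

theorem exists_mul_le_and_not_le (hO : IsMaximalOrder O) (hP : IsMaxIdeal O P) :
    ∃ D, IsSubbimodule O D ∧ P * D ≤ 𝒪 ∧ D * P ≤ 𝒪 ∧ ¬ D ≤ 𝒪 := by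
  obtain ⟨n, hn, hnP⟩ := hP.exists_int
  obtain ⟨B, C, hB, hC, hBPC, hCB⟩ := hP.exists_mul_mul_le_smul hO.prop hn hnP
  have hn' : (n : ℚ) ≠ 0 := Int.cast_ne_zero.mpr hn
  have hCB_sub := hC.toIsSubbimodule.mul hB.toIsSubbimodule
  have hBPC' : (n : ℚ)⁻¹ • (B * (P * C)) ≤ 𝒪 := by
    simpa [inv_smul_smul₀ hn'] using smul_mono_right (n : ℚ)⁻¹ hBPC
  refine ⟨(n : ℚ)⁻¹ • (C * B), ⟨?_, ?_⟩, hO.le_of_mul_le_right hB ?_,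
    hO.le_of_mul_le_left hC ?_, fun h => hCB ?_⟩
  · rw [mul_smul_comm, hCB_sub.left_eq]
  · rw [smul_mul_assoc, hCB_sub.right_eq]
  · calc B * (P * (n : ℚ)⁻¹ • (C * B)) = (n : ℚ)⁻¹ • (B * (P * C)) * B := by
          simp only [mul_smul_comm, smul_mul_assoc, mul_assoc]
      _ ≤ B := (mul_le_mul_left hBPC' B).trans hB.left
  · calc (n : ℚ)⁻¹ • (C * B) * P * C = C * (n : ℚ)⁻¹ • (B * (P * C)) := by
          simp only [mul_smul_comm, smul_mul_assoc, mul_assoc]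
      _ ≤ C := (mul_le_mul_right hBPC' C).trans hC.right
  · simpa [smul_inv_smul₀ hn'] using smul_mono_right (n : ℚ) h

theorem isInvertible (hO : IsMaximalOrder O) (hP : IsMaxIdeal O P) : IsInvertible O P := by
  obtain ⟨D, hD, hPD, hDP, hDO⟩ := hP.exists_mul_le_and_not_le hO
  have hPf := hP.toIsFullIdeal
  have hD' : IsSubbimodule O (D ⊔ 𝒪) := hD.sup .self
  have hP_le : P ≤ P * (D ⊔ 𝒪) := by rw [Submodule.mul_sup, hPf.right_eq]; exact le_sup_right
  have hP_le' : P ≤ (D ⊔ 𝒪) * P := by rw [Submodule.sup_mul, hPf.left_eq]; exact le_sup_right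
  have hfull : IsFullIdeal O (P * (D ⊔ 𝒪)) := by
    refine hPf.of_le hP_le ?_ (hPf.toIsSubbimodule.mul hD')
    rw [Submodule.mul_sup, hPf.right_eq]
    exact sup_le hPD hPf.le
  have hfull' : IsFullIdeal O ((D ⊔ 𝒪) * P) := by
    refine hPf.of_le hP_le' ?_ (hD'.mul hPf.toIsSubbimodule)
    rw [Submodule.sup_mul, hPf.left_eq]
    exact sup_le hDP hPf.le
  refine ⟨D ⊔ 𝒪, hD', ?_, ?_⟩
  · exact (hP.eq_or_eq _ hfull hP_le).resolve_left fun h =>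
      hDO (le_sup_left.trans (hO.le_of_mul_le_right hPf h.le))
  · exact (hP.eq_or_eq _ hfull' hP_le').resolve_left fun h =>
      hDO (le_sup_left.trans (hO.le_of_mul_le_left hPf h.le))

end IsMaxIdeal

theorem IsMaximalOrder.maxIdealsInvertible (hO : IsMaximalOrder O) : MaxIdealsInvertible O :=
  fun _ hP => hP.isInvertible hO

end MaximalOrders

section IdealAction

variable {R A : Type*} [CommRing R] [Ring A] [Algebra R A] {O : Subalgebra R A} {V : Type*}
  [AddCommGroup V] [Module A V] {P Q : Submodule R A} {N N' : Submodule O V}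

local notation "𝒪" => Subalgebra.toSubmodule O

/-- The product `P N` of a subset `P` of `A`, such as a fractional ideal of `O`, with an
`O`-submodule `N` of an `A`-module. -/
def idealSMul (P : Submodule R A) (N : Submodule O V) : Submodule O V :=
  Submodule.span O (Set.image2 (· • ·) (P : Set A) N)

theorem smul_mem_idealSMul {r : A} (hr : r ∈ P) {x : V} (hx : x ∈ N) : r • x ∈ idealSMul P N :=
  Submodule.subset_span (Set.mem_image2_of_mem hr hx)

theorem idealSMul_le_iff : idealSMul P N ≤ N' ↔ ∀ r ∈ P, ∀ x ∈ N, r • x ∈ N' :=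
  Submodule.span_le.trans Set.image2_subset_iff

theorem idealSMul_mono (h : N ≤ N') : idealSMul P N ≤ idealSMul P N' :=
  idealSMul_le_iff.mpr fun _ hr _ hx => smul_mem_idealSMul hr (h hx)

theorem idealSMul_le (hP : P ≤ 𝒪) (N : Submodule O V) : idealSMul P N ≤ N :=
  idealSMul_le_iff.mpr fun r hr _ hx => N.smul_mem (⟨r, hP hr⟩ : O) hx

theorem idealSMul_self (N : Submodule O V) : idealSMul 𝒪 N = N :=
  le_antisymm (idealSMul_le le_rfl N) fun x hx => by
    simpa using smul_mem_idealSMul (show (1 : A) ∈ 𝒪 from O.one_mem) hx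

theorem idealSMul_mul (hP : P * 𝒪 ≤ P) (N : Submodule O V) :
    idealSMul (P * Q) N = idealSMul P (idealSMul Q N) := by
  refine le_antisymm (idealSMul_le_iff.mpr fun t ht x hx => ?_)
    (idealSMul_le_iff.mpr fun p hp y hy => ?_)
  · induction ht using Submodule.mul_induction_on' with
    | mem_mul_mem p hp q hq =>
      rw [mul_smul]
      exact smul_mem_idealSMul hp (smul_mem_idealSMul hq hx)
    | add s _ t _ hs ht =>
      rw [add_smul]
      exact add_mem hs ht
  · induction hy using Submodule.span_induction generalizing p with
    | mem y hy =>
      obtain ⟨q, hq, x, hx, rfl⟩ := hy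
      simpa only [mul_smul] using smul_mem_idealSMul (Submodule.mul_mem_mul hp hq) hx
    | zero => rw [smul_zero]; exact zero_mem _
    | add y z _ _ hy hz => rw [smul_add]; exact add_mem (hy p hp) (hz p hp)
    | smul c y _ hy =>
      rw [Subalgebra.smul_def, ← mul_smul]
      exact hy _ (hP (Submodule.mul_mem_mul hp c.2))

theorem idealSMul_idealSMul_of_mul_eq {D : Submodule R A} (hD : D * 𝒪 ≤ D) (h : D * P = 𝒪)
    (N : Submodule O V) : idealSMul D (idealSMul P N) = N := by
  rw [← idealSMul_mul hD, h, idealSMul_self]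

/-- Multiplication by an invertible ideal, as an automorphism of the lattice of submodules. -/
def idealSMulOrderIso {D : Submodule R A} (hP : P * 𝒪 ≤ P) (hD : D * 𝒪 ≤ D) (hDP : D * P = 𝒪)
    (hPD : P * D = 𝒪) : Submodule O V ≃o Submodule O V where
  toFun := idealSMul P
  invFun := idealSMul D
  left_inv := idealSMul_idealSMul_of_mul_eq hD hDP
  right_inv := idealSMul_idealSMul_of_mul_eq hP hPD
  map_rel_iff' {N N'} := by
    refine ⟨fun h => ?_, idealSMul_mono⟩
    simpa only [Equiv.coe_fn_mk, idealSMul_idealSMul_of_mul_eq hD hDP] using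
      idealSMul_mono (P := D) h

theorem hom_eq_zero_of_mem_idealSMul_annIdeal {K : Type*} [AddCommGroup K] [Module O K]
    (f : N →ₗ[O] K) {x : N} (hx : (x : V) ∈ idealSMul (annIdeal O K) N) : f x = 0 := by
  have hle : idealSMul (annIdeal O K) N ≤ (LinearMap.ker f).map N.subtype := by
    rw [idealSMul_le_iff]
    rintro _ ⟨r, hr, rfl⟩ y hy
    refine ⟨r • ⟨y, hy⟩, ?_, rfl⟩
    exact (f.map_smul r _).trans (Module.mem_annihilator.mp hr _)
  obtain ⟨y, hy, hyx⟩ := hle hx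
  rwa [← Subtype.ext hyx]

end IdealAction

section RelativeIndex

variable {R V : Type*} [Ring R] [AddCommGroup V] [Module R V] {L M M' N N' : Submodule R V}

/-- The index of `N' ⊓ N` in `N`, with value `0` if this index is infinite. -/
def relIdx (N' N : Submodule R V) : ℕ := N'.toAddSubgroup.relIndex N.toAddSubgroup

theorem relIdx_eq_natCard : relIdx N' N = Nat.card (N ⧸ N'.submoduleOf N) := rfl

theorem relIdx_mul_relIdx (hLM : L ≤ M) (hMN : M ≤ N) : relIdx L M * relIdx M N = relIdx L N :=
  AddSubgroup.relIndex_mul_relIndex _ _ _ hLM hMN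

theorem relIdx_self : relIdx N N = 1 := AddSubgroup.relIndex_self _

theorem relIdx_eq_one : relIdx N' N = 1 ↔ N ≤ N' := AddSubgroup.relIndex_eq_one

theorem one_lt_relIdx (h : ¬ N ≤ N') (h0 : relIdx N' N ≠ 0) : 1 < relIdx N' N :=
  lt_of_le_of_ne (Nat.one_le_iff_ne_zero.mpr h0) fun h1 => h (relIdx_eq_one.mp h1.symm)

theorem relIdx_map_of_injective {W : Type*} [AddCommGroup W] [Module R W] {j : W →ₗ[R] V}
    (hj : Function.Injective j) (N' N : Submodule R W) :
    relIdx (N'.map j) (N.map j) = relIdx N' N :=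
  AddSubgroup.relIndex_map_map_of_injective N'.toAddSubgroup N.toAddSubgroup
    (f := j.toAddMonoidHom) hj

theorem relIdx_top_ne_zero (N : Submodule R V) [Finite (V ⧸ N)] : relIdx N ⊤ ≠ 0 := by
  have : relIdx N ⊤ = Nat.card (V ⧸ N) := AddSubgroup.relIndex_top_right _
  rw [this]
  exact Nat.card_pos.ne'

theorem exists_covBy_of_relIdx_ne_zero (h : N' < N) (h0 : relIdx N' N ≠ 0) :
    ∃ M, N' ≤ M ∧ M ⋖ N := by
  obtain ⟨M, ⟨hN'M, hMN⟩, hmin⟩ := exists_minimalFor_of_wellFoundedLT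
    (fun M => N' ≤ M ∧ M < N) (relIdx · N) ⟨N', le_rfl, h⟩
  refine ⟨M, hN'M, hMN, fun L hML hLN => ?_⟩
  have hmul := relIdx_mul_relIdx hML.le hLN.le
  have hM0 : relIdx M N ≠ 0 := right_ne_zero_of_mul (relIdx_mul_relIdx hN'M hMN.le ▸ h0)
  have hL0 : relIdx L N ≠ 0 := right_ne_zero_of_mul (hmul ▸ hM0)
  have hlt : relIdx L N < relIdx M N := hmul ▸ lt_mul_of_one_lt_left (Nat.pos_of_ne_zero hL0)
    (one_lt_relIdx hML.not_ge (left_ne_zero_of_mul (hmul ▸ hM0)))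
  exact (hmin (j := L) ⟨hN'M.trans hML.le, hLN⟩ hlt.le).not_gt hlt

theorem mem_annihilator_quotient_submoduleOf {r : R} :
    r ∈ Module.annihilator R (N ⧸ N'.submoduleOf N) ↔ ∀ x ∈ N, r • x ∈ N' := by
  simp only [Module.mem_annihilator, (Submodule.Quotient.mk_surjective _).forall,
    ← Submodule.Quotient.mk_smul, Submodule.Quotient.mk_eq_zero, Subtype.forall]
  rfl

theorem relIdx_eq_of_covBy (hN : N' ⋖ N) (hM : M' ⋖ M) (h0 : relIdx N' N ≠ 0)
    (hann : Module.annihilator R (N ⧸ N'.submoduleOf N) ≤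
      Module.annihilator R (M ⧸ M'.submoduleOf M)) :
    relIdx M' M = relIdx N' N := by
  have : IsSimpleModule R (N ⧸ N'.submoduleOf N) := (covBy_iff_quot_is_simple hN.le).mp hN
  have : IsSimpleModule R (M ⧸ M'.submoduleOf M) := (covBy_iff_quot_is_simple hM.le).mp hM
  have : Finite (N ⧸ N'.submoduleOf N) := Nat.finite_of_card_ne_zero h0
  obtain ⟨f⟩ := nonempty_linearEquiv_of_annihilator_le hann
  exact Nat.card_congr f.toEquiv

end RelativeIndex

section LatticeHoms

variable {R A : Type*} [CommRing R] [Ring A] [Algebra R A] {O : Subalgebra R A} {V : Type*}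
  [AddCommGroup V] [Module A V]

theorem relIdx_idealSMul_ne_zero [Module.Finite R O] {P : Submodule R A} {n : ℤ}
    [Finite (R ⧸ Ideal.span {(n : R)})] (hn : (n : A) ∈ P) {N : Submodule O V} (hfg : N.FG) :
    relIdx (idealSMul P N) N ≠ 0 := by
  have : Module.Finite O N := Module.Finite.iff_fg.mpr hfg
  have : Finite (N ⧸ (idealSMul P N).submoduleOf N) := by
    refine finite_of_zsmul_eq_zero (n := n) (R := R) (A := O) fun y => ?_
    obtain ⟨x, rfl⟩ := Submodule.Quotient.mk_surjective _ y
    rw [← Submodule.Quotient.mk_smul, Submodule.Quotient.mk_eq_zero]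
    simpa [Submodule.submoduleOf, Int.cast_smul_eq_zsmul] using smul_mem_idealSMul hn x.2
  rw [relIdx_eq_natCard]
  exact Nat.card_pos.ne'

theorem natCard_hom_eq_of_relIdx_idealSMul_eq {K : Type*} [AddCommGroup K] [Module O K] [Finite K]
    [IsSimpleModule O K] {M N : Submodule O V} (h0 : relIdx (idealSMul (annIdeal O K) M) M ≠ 0)
    (h : relIdx (idealSMul (annIdeal O K) N) N = relIdx (idealSMul (annIdeal O K) M) M) :
    Nat.card (N →ₗ[O] K) = Nat.card (M →ₗ[O] K) := by
  let QM := (idealSMul (annIdeal O K) M).submoduleOf M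
  let QN := (idealSMul (annIdeal O K) N).submoduleOf N
  have : Finite (M ⧸ QM) := Nat.finite_of_card_ne_zero h0
  have : Finite (N ⧸ QN) := Nat.finite_of_card_ne_zero (h.trans_ne h0)
  have hann (L : Submodule O V) : Module.annihilator O K ≤
      Module.annihilator O (L ⧸ (idealSMul (annIdeal O K) L).submoduleOf L) := fun r hr =>
    mem_annihilator_quotient_submoduleOf.mpr fun x hx =>
      smul_mem_idealSMul (coe_mem_annIdeal.mpr hr) hx
  calc Nat.card (N →ₗ[O] K)
      = Nat.card (N ⧸ QN →ₗ[O] K) := (natCard_hom_quotient QN fun f _ hx =>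
          hom_eq_zero_of_mem_idealSMul_annIdeal f hx).symm
    _ = Nat.card (M ⧸ QM →ₗ[O] K) := natCard_hom_eq_of_natCard_eq (hann N) (hann M) h
    _ = Nat.card (M →ₗ[O] K) := natCard_hom_quotient QM fun f _ hx =>
          hom_eq_zero_of_mem_idealSMul_annIdeal f hx

variable (O) in
/-- The inclusion of `O ^ d` in `A ^ d`. -/
def freeInclusion (d : ℕ) : (Fin d → O) →ₗ[O] (Fin d → A) where
  toFun x i := x i
  map_add' _ _ := rfl
  map_smul' _ _ := rfl

theorem freeInclusion_injective (d : ℕ) : Function.Injective (freeInclusion O d) :=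
  fun _ _ h => funext fun i => Subtype.ext (congrFun h i)

end LatticeHoms

section LatticeIndices

variable {R A : Type*} [CommRing R] [Ring A] [Algebra R A] {O : Subalgebra R A} {V : Type*}
  [AddCommGroup V] [Module A V] {P : Submodule R A} {N N' : Submodule O V}

-- `N / N'` and `P N / P N'` are simple with the same annihilator, because `P` commutes with it.
theorem relIdx_idealSMul_of_covBy (hinv : MaxIdealsInvertible O) (hP : IsMaxIdeal O P) (h : N' ⋖ N)
    (h0 : relIdx N' N ≠ 0) : relIdx (idealSMul P N') (idealSMul P N) = relIdx N' N := by
  obtain ⟨D, hD, hPD, hDP⟩ := hinv P hP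
  have hcov : idealSMul P N' ⋖ idealSMul P N :=
    (apply_covBy_apply_iff (idealSMulOrderIso hP.right hD.right hDP hPD)).mpr h
  let K := N ⧸ N'.submoduleOf N
  have : Finite K := Nat.finite_of_card_ne_zero h0
  have : IsSimpleModule O K := (covBy_iff_quot_is_simple h.le).mp h
  have hQ : IsMaxIdeal O (annIdeal O K) := isMaxIdeal_annIdeal
  have hQN : idealSMul (annIdeal O K) N ≤ N' := by
    rw [idealSMul_le_iff]
    rintro _ ⟨r, hr, rfl⟩ x hx
    exact mem_annihilator_quotient_submoduleOf.mp hr x hx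
  have hQPN : idealSMul (annIdeal O K) (idealSMul P N) ≤ idealSMul P N' := by
    rw [← idealSMul_mul hQ.right, hQ.mul_comm hP (hinv _ hQ) (hinv _ hP), idealSMul_mul hP.right]
    exact idealSMul_mono hQN
  exact relIdx_eq_of_covBy h hcov h0 fun r hr => mem_annihilator_quotient_submoduleOf.mpr
    fun x hx => hQPN (smul_mem_idealSMul (coe_mem_annIdeal.mpr hr) hx)

theorem relIdx_idealSMul (hinv : MaxIdealsInvertible O) (hP : IsMaxIdeal O P) (h : N' ≤ N)
    (h0 : relIdx N' N ≠ 0) : relIdx (idealSMul P N') (idealSMul P N) = relIdx N' N := by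
  induction hk : relIdx N' N using Nat.strong_induction_on generalizing N with
  | _ k ih =>
    subst hk
    rcases h.eq_or_lt with rfl | hlt
    · rw [relIdx_self, relIdx_self]
    · obtain ⟨M, hN'M, hMN⟩ := exists_covBy_of_relIdx_ne_zero hlt h0
      have hmul := relIdx_mul_relIdx hN'M hMN.le
      have hM : relIdx N' M ≠ 0 := left_ne_zero_of_mul (hmul ▸ h0)
      have hN : relIdx M N ≠ 0 := right_ne_zero_of_mul (hmul ▸ h0)
      have hdecr : relIdx N' M < relIdx N' N := hmul ▸
        lt_mul_of_one_lt_right (Nat.pos_of_ne_zero hM) (one_lt_relIdx hMN.lt.not_ge hN)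
      rw [← relIdx_mul_relIdx (idealSMul_mono hN'M) (idealSMul_mono hMN.le),
        ih _ hdecr hN'M hM rfl, relIdx_idealSMul_of_covBy hinv hP hMN hN, hmul]

theorem relIdx_idealSMul_self (hinv : MaxIdealsInvertible O) (hP : IsMaxIdeal O P) (h : N' ≤ N)
    (h0 : relIdx N' N ≠ 0) : relIdx (idealSMul P N') N' = relIdx (idealSMul P N) N := by
  refine mul_right_cancel₀ h0 ?_
  calc relIdx (idealSMul P N') N' * relIdx N' N
      = relIdx (idealSMul P N') N := relIdx_mul_relIdx (idealSMul_le hP.le N') h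
    _ = relIdx (idealSMul P N') (idealSMul P N) * relIdx (idealSMul P N) N :=
      (relIdx_mul_relIdx (idealSMul_mono h) (idealSMul_le hP.le N)).symm
    _ = relIdx (idealSMul P N) N * relIdx N' N := by
      rw [relIdx_idealSMul hinv hP h h0, mul_comm]

variable [Module.Finite R O] {K : Type*} [AddCommGroup K] [Module O K] [Finite K]
  [IsSimpleModule O K]

theorem natCard_hom_eq_of_relIdx_ne_zero
    (hR : ∀ n : ℤ, n ≠ 0 → Finite (R ⧸ Ideal.span {(n : R)})) (hinv : MaxIdealsInvertible O)
    (h : N' ≤ N) (h0 : relIdx N' N ≠ 0) (hfg : N.FG) :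
    Nat.card (N' →ₗ[O] K) = Nat.card (N →ₗ[O] K) := by
  have hP : IsMaxIdeal O (annIdeal O K) := isMaxIdeal_annIdeal
  obtain ⟨n, hn, hnP⟩ := hP.exists_int
  have := hR n hn
  exact natCard_hom_eq_of_relIdx_idealSMul_eq (relIdx_idealSMul_ne_zero hnP hfg)
    (relIdx_idealSMul_self hinv hP h h0)

theorem natCard_hom_eq_of_finite_quotient
    (hR : ∀ n : ℤ, n ≠ 0 → Finite (R ⧸ Ideal.span {(n : R)})) (hinv : MaxIdealsInvertible O) {d : ℕ}
    (N : Submodule O (Fin d → O)) [Finite ((Fin d → O) ⧸ N)] :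
    Nat.card (N →ₗ[O] K) = Nat.card ((Fin d → O) →ₗ[O] K) := by
  have hj := freeInclusion_injective (O := O) d
  calc Nat.card (N →ₗ[O] K)
      = Nat.card (N.map (freeInclusion O d) →ₗ[O] K) :=
        natCard_hom_congr (N.equivMapOfInjective _ hj)
    _ = Nat.card ((⊤ : Submodule O (Fin d → O)).map (freeInclusion O d) →ₗ[O] K) :=
        natCard_hom_eq_of_relIdx_ne_zero hR hinv (Submodule.map_mono le_top)
          ((relIdx_map_of_injective hj N ⊤).trans_ne (relIdx_top_ne_zero N))
          (Module.Finite.fg_top.map _)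
    _ = Nat.card ((Fin d → O) →ₗ[O] K) :=
        natCard_hom_congr ((Submodule.equivMapOfInjective _ hj ⊤).symm.trans Submodule.topEquiv)

end LatticeIndices

section Extensions

variable {R : Type*} [Ring R] {Q F M X E : Type*} [AddCommGroup Q] [Module R Q]
  [AddCommGroup F] [Module R F] [AddCommGroup M] [Module R M] [AddCommGroup X] [Module R X]
  [AddCommGroup E] [Module R E]

section Lifts

variable {p : Q →ₗ[R] F} {φ : X →ₗ[R] F} {s : Q →ₗ[R] X} {ι : M →ₗ[R] E} {π : E →ₗ[R] F}

/-- The map `ker p → ker φ` induced by a map `s` with `φ ∘ s = p`. -/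
def kerMap (hs : φ ∘ₗ s = p) : LinearMap.ker p →ₗ[R] LinearMap.ker φ :=
  s.restrict fun y hy => (LinearMap.congr_fun hs y).trans hy

theorem coprod_subtype_ker_surjective (hp : Function.Surjective p) (hs : φ ∘ₗ s = p) :
    Function.Surjective (s.coprod (LinearMap.ker φ).subtype) := by
  intro x
  obtain ⟨y, hy⟩ := hp (φ x)
  have hker : φ (x - s y) = 0 := by
    rw [map_sub, ← LinearMap.comp_apply, hs, hy, sub_self]
  exact ⟨(y, ⟨x - s y, hker⟩), by simp⟩

theorem hom_ext_of_comp_eq_of_eqOn_ker (hp : Function.Surjective p) (hs : φ ∘ₗ s = p)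
    {θ θ' : X →ₗ[R] E} (h : θ ∘ₗ s = θ' ∘ₗ s)
    (hker : θ ∘ₗ (LinearMap.ker φ).subtype = θ' ∘ₗ (LinearMap.ker φ).subtype) : θ = θ' := by
  refine (LinearMap.cancel_right (coprod_subtype_ker_surjective hp hs)).mp ?_
  rw [LinearMap.comp_coprod, LinearMap.comp_coprod, h, hker]

theorem exists_hom_comp_eq_of_eqOn_ker (hp : Function.Surjective p) (hs : φ ∘ₗ s = p)
    (f : Q →ₗ[R] E) (g : LinearMap.ker φ →ₗ[R] E)
    (h : f ∘ₗ (LinearMap.ker p).subtype = g ∘ₗ kerMap hs) :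
    ∃ θ : X →ₗ[R] E, θ ∘ₗ s = f ∧ θ ∘ₗ (LinearMap.ker φ).subtype = g := by
  have hker : LinearMap.ker (s.coprod (LinearMap.ker φ).subtype) ≤
      LinearMap.ker (f.coprod g) := by
    rintro ⟨y, k⟩ hyk
    replace hyk : s y + k = 0 := hyk
    have hy : p y = 0 := by
      rw [← hs, LinearMap.comp_apply, eq_neg_of_add_eq_zero_left hyk, map_neg, k.2, neg_zero]
    have hk : k = -kerMap hs ⟨y, hy⟩ := Subtype.ext (eq_neg_of_add_eq_zero_right hyk)
    have hfg : f y = g (kerMap hs ⟨y, hy⟩) := LinearMap.congr_fun h ⟨y, hy⟩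
    rw [LinearMap.mem_ker, LinearMap.coprod_apply, hfg, hk, map_neg, add_neg_cancel]
  obtain ⟨θ, hθ⟩ := exists_comp_eq_of_ker_le (coprod_subtype_ker_surjective hp hs) _ hker
  rw [LinearMap.comp_coprod] at hθ
  exact ⟨θ, by simpa using congrArg (· ∘ₗ LinearMap.inl R Q (LinearMap.ker φ)) hθ,
    by simpa using congrArg (· ∘ₗ LinearMap.inr R Q (LinearMap.ker φ)) hθ⟩

theorem surjective_iff_of_exact (hφ : Function.Surjective φ) (hι : Function.Injective ι)
    (hex : Function.Exact ι π) {θ : X →ₗ[R] E} (hθ : π ∘ₗ θ = φ) {ψ : LinearMap.ker φ →ₗ[R] M}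
    (hψ : ι ∘ₗ ψ = θ ∘ₗ (LinearMap.ker φ).subtype) :
    Function.Surjective θ ↔ Function.Surjective ψ := by
  have hψ' (k : LinearMap.ker φ) : ι (ψ k) = θ k := LinearMap.congr_fun hψ k
  have hθ' (x : X) : π (θ x) = φ x := LinearMap.congr_fun hθ x
  refine ⟨fun h m => ?_, fun h z => ?_⟩
  · obtain ⟨x, hx⟩ := h (ι m)
    exact ⟨⟨x, by rw [LinearMap.mem_ker, ← hθ', hx, hex.apply_apply_eq_zero]⟩,
      hι (by rw [hψ', hx])⟩
  · obtain ⟨x, hx⟩ := hφ (π z)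
    obtain ⟨m, hm⟩ := (hex (z - θ x)).mp (by rw [map_sub, hθ', hx, sub_self])
    obtain ⟨k, rfl⟩ := h m
    exact ⟨x + k, by rw [map_add, ← hψ', hm, add_sub_cancel]⟩

theorem exists_comp_eq_of_exact (hι : Function.Injective ι) (hex : Function.Exact ι π)
    {f : X →ₗ[R] E} (hf : π ∘ₗ f = 0) : ∃ g : X →ₗ[R] M, ι ∘ₗ g = f :=
  exists_comp_eq_of_range_le hι f (by rwa [← hex.linearMap_ker_eq, LinearMap.range_le_ker_iff])

/- A lift `θ` corresponds to the pair `(ψ, h)` with `ι ∘ ψ = θ|_{ker φ}` and `ι ∘ h = θ ∘ s - κ`,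
where `κ` exhibits `E` as the extension of class `η`. -/
theorem natCard_surjective_lifts (hp : Function.Surjective p) (hφ : Function.Surjective φ)
    (hs : φ ∘ₗ s = p) (hι : Function.Injective ι) (hex : Function.Exact ι π) {κ : Q →ₗ[R] E}
    (hκ : π ∘ₗ κ = p) {η : LinearMap.ker p →ₗ[R] M}
    (hη : κ ∘ₗ (LinearMap.ker p).subtype = ι ∘ₗ η) :
    Nat.card {θ : X →ₗ[R] E // Function.Surjective θ ∧ π ∘ₗ θ = φ} =
      Nat.card {q : (LinearMap.ker φ →ₗ[R] M) × (Q →ₗ[R] M) // Function.Surjective q.1 ∧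
        q.1 ∘ₗ kerMap hs - q.2 ∘ₗ (LinearMap.ker p).subtype = η} := by
  have hπι : π ∘ₗ ι = 0 := hex.linearMap_comp_eq_zero
  have hψ_exists (θ : {θ : X →ₗ[R] E // Function.Surjective θ ∧ π ∘ₗ θ = φ}) :
      ∃ ψ, ι ∘ₗ ψ = θ.1 ∘ₗ (LinearMap.ker φ).subtype :=
    exists_comp_eq_of_exact hι hex
      (by rw [← LinearMap.comp_assoc, θ.2.2, LinearMap.comp_ker_subtype])
  have hh_exists (θ : {θ : X →ₗ[R] E // Function.Surjective θ ∧ π ∘ₗ θ = φ}) :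
      ∃ h, ι ∘ₗ h = θ.1 ∘ₗ s - κ :=
    exists_comp_eq_of_exact hι hex
      (by rw [LinearMap.comp_sub, ← LinearMap.comp_assoc, θ.2.2, hs, hκ, sub_self])
  choose ψ hψ using hψ_exists
  choose h hh using hh_exists
  refine Nat.card_congr (Equiv.ofBijective (fun θ => ⟨(ψ θ, h θ),
    (surjective_iff_of_exact hφ hι hex θ.2.2 (hψ θ)).mp θ.2.1, ?_⟩) ⟨?_, ?_⟩)
  · rw [← LinearMap.cancel_left hι, LinearMap.comp_sub, ← LinearMap.comp_assoc,
      ← LinearMap.comp_assoc, hψ, hh, LinearMap.sub_comp, hη]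
    exact sub_sub_cancel _ _
  · intro θ θ' heq
    obtain ⟨hψeq : ψ θ = ψ θ', hheq : h θ = h θ'⟩ := Prod.mk.inj (congrArg Subtype.val heq)
    refine Subtype.ext (hom_ext_of_comp_eq_of_eqOn_ker hp hs ?_ ?_)
    · rw [← sub_left_inj (a := κ), ← hh, ← hh, hheq]
    · rw [← hψ, ← hψ, hψeq]
  · rintro ⟨⟨ψ', h'⟩, hsurj, hη'⟩
    obtain ⟨θ, hθs, hθk⟩ := exists_hom_comp_eq_of_eqOn_ker hp hs (κ + ι ∘ₗ h') (ι ∘ₗ ψ') <| by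
      rw [LinearMap.add_comp, hη, LinearMap.comp_assoc, ← LinearMap.comp_add, ← hη',
        sub_add_cancel, LinearMap.comp_assoc]
    have hπθ : π ∘ₗ θ = φ := hom_ext_of_comp_eq_of_eqOn_ker hp hs
      (by rw [LinearMap.comp_assoc, hθs, LinearMap.comp_add, ← LinearMap.comp_assoc h' ι, hπι,
        LinearMap.zero_comp, add_zero, hκ, hs])
      (by rw [LinearMap.comp_assoc, hθk, ← LinearMap.comp_assoc, hπι, LinearMap.zero_comp,
        LinearMap.comp_ker_subtype])
    refine ⟨⟨θ, (surjective_iff_of_exact hφ hι hex hπθ hθk.symm).mpr hsurj, hπθ⟩,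
      Subtype.ext (Prod.ext ?_ ?_)⟩
    · rw [← LinearMap.cancel_left hι, hψ, hθk]
    · rw [← LinearMap.cancel_left hι, hh, hθs, add_sub_cancel_left]

theorem natCard_surjective_eq_sum_lifts [Finite X] [Finite E]
    (hπ : Function.Surjective π) [Fintype {φ : X →ₗ[R] F // Function.Surjective φ}] :
    Nat.card {θ : X →ₗ[R] E // Function.Surjective θ} =
      ∑ φ : {φ : X →ₗ[R] F // Function.Surjective φ},
        Nat.card {θ : X →ₗ[R] E // Function.Surjective θ ∧ π ∘ₗ θ = φ} := by
  let compose : {θ : X →ₗ[R] E // Function.Surjective θ} →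
      {φ : X →ₗ[R] F // Function.Surjective φ} :=
    fun θ => ⟨π ∘ₗ θ.1, by rw [LinearMap.coe_comp]; exact hπ.comp θ.2⟩
  rw [← Nat.card_congr (Equiv.sigmaFiberEquiv compose), Nat.card_sigma]
  exact Finset.sum_congr rfl fun φ _ => Nat.card_congr
    { toFun := fun θ => ⟨θ.1.1, θ.1.2, congrArg Subtype.val θ.2⟩
      invFun := fun θ => ⟨⟨θ.1, θ.2.1⟩, Subtype.ext θ.2.2⟩
      left_inv := fun θ => rfl
      right_inv := fun θ => rfl }

theorem finite_of_exact (hex : Function.Exact ι π) [Finite M] [Finite F] : Finite E := by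
  have : Finite (LinearMap.range ι) := Set.finite_range ι
  have : Finite (E ⧸ (LinearMap.range ι).toAddSubgroup) := by
    rw [← hex.linearMap_ker_eq]
    exact .of_equiv _ π.quotKerEquivRange.toEquiv.symm
  exact .of_addSubgroup_quotient (H := (LinearMap.range ι).toAddSubgroup)

end Lifts

theorem sum_natCard_fiber {α β γ : Type*} [Finite α] [Finite β] [Fintype γ] (P : α → Prop)
    (f : α × β → γ) :
    ∑ c, Nat.card {q : α × β // P q.1 ∧ f q = c} = Nat.card ({a : α // P a} × β) := by
  rw [← Nat.card_congr (Equiv.sigmaFiberEquiv fun q : {a : α // P a} × β => f (q.1.1, q.2)),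
    Nat.card_sigma]
  exact Finset.sum_congr rfl fun c _ => Nat.card_congr
    { toFun := fun q => ⟨(⟨q.1.1, q.2.1⟩, q.1.2), q.2.2⟩
      invFun := fun q => ⟨(q.1.1.1, q.1.2), q.1.1.2, q.2⟩
      left_inv := fun _ => rfl
      right_inv := fun _ => rfl }

section Pushout

variable {p : Q →ₗ[R] F} (η : LinearMap.ker p →ₗ[R] M)

/-- The pushout of `Q ← ker p → M` along `η`. When `p` is surjective this is an extension of `F`
by `M`, and every extension arises in this way if `Q` is projective. -/
abbrev Pushout : Type _ :=
  (Q × M) ⧸ LinearMap.range ((LinearMap.ker p).subtype.prod (-η))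

/-- The canonical map from `M` to the pushout. -/
def Pushout.inr : M →ₗ[R] Pushout η :=
  Submodule.mkQ _ ∘ₗ LinearMap.inr R Q M

/-- The canonical map from `Q` to the pushout. -/
def Pushout.inl : Q →ₗ[R] Pushout η :=
  Submodule.mkQ _ ∘ₗ LinearMap.inl R Q M

/-- The projection of the extension to `F`. -/
def Pushout.proj : Pushout η →ₗ[R] F :=
  Submodule.liftQ _ (p ∘ₗ LinearMap.fst R Q M) (by
    rintro _ ⟨y, rfl⟩
    exact y.2)

theorem Pushout.inr_injective : Function.Injective (Pushout.inr η) := by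
  rw [← LinearMap.ker_eq_bot, LinearMap.ker_eq_bot']
  intro m hm
  obtain ⟨y, hy⟩ := (Submodule.Quotient.mk_eq_zero _).mp hm
  obtain ⟨hy0 : (y : Q) = 0, hym : -η y = m⟩ := Prod.mk.inj hy
  rw [← hym, show y = 0 from Subtype.ext hy0, map_zero, neg_zero]

theorem Pushout.inl_comp_subtype :
    Pushout.inl η ∘ₗ (LinearMap.ker p).subtype = Pushout.inr η ∘ₗ η :=
  LinearMap.ext fun y => (Submodule.Quotient.eq _).mpr ⟨y, by simp⟩

theorem Pushout.proj_comp_inl : Pushout.proj η ∘ₗ Pushout.inl η = p :=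
  rfl

theorem Pushout.exact_inr_proj : Function.Exact (Pushout.inr η) (Pushout.proj η) := by
  intro z
  constructor
  · intro hz
    obtain ⟨⟨y, m⟩, rfl⟩ := Submodule.Quotient.mk_surjective _ z
    have hy : Pushout.inl η y = Pushout.inr η (η ⟨y, hz⟩) :=
      LinearMap.congr_fun (Pushout.inl_comp_subtype η) ⟨y, hz⟩
    refine ⟨η ⟨y, hz⟩ + m, ?_⟩
    rw [map_add, ← hy]
    simp only [Pushout.inl, Pushout.inr, LinearMap.comp_apply, Submodule.mkQ_apply,
      LinearMap.inl_apply, LinearMap.inr_apply, ← Submodule.Quotient.mk_add, Prod.mk_add_mk,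
      add_zero, zero_add]
  · rintro ⟨m, rfl⟩
    exact map_zero p

theorem Pushout.proj_surjective (hp : Function.Surjective p) :
    Function.Surjective (Pushout.proj η) :=
  Function.Surjective.of_comp (g := Pushout.inl η) hp

theorem Pushout.finite [Finite F] [Finite M] : Finite (Pushout η) :=
  finite_of_exact (Pushout.exact_inr_proj η)

/- Both sides count the pairs `(φ, q)`; on the left they are sorted by the class `η` they induce. -/
theorem sum_natCard_surjective_pushout [Module.Projective R Q] (hp : Function.Surjective p)
    [Finite X] [Finite M] [Finite F] [Fintype (LinearMap.ker p →ₗ[R] M)]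
    [Fintype {φ : X →ₗ[R] F // Function.Surjective φ}] [Finite (Q →ₗ[R] M)] :
    ∑ η : LinearMap.ker p →ₗ[R] M, Nat.card {θ : X →ₗ[R] Pushout η // Function.Surjective θ} =
      (∑ φ : {φ : X →ₗ[R] F // Function.Surjective φ},
        Nat.card {ψ : LinearMap.ker φ.1 →ₗ[R] M // Function.Surjective ψ}) *
          Nat.card (Q →ₗ[R] M) := by
  choose s hs using fun φ : {φ : X →ₗ[R] F // Function.Surjective φ} =>
    Module.projective_lifting_property φ.1 p φ.2
  have hlifts (η : LinearMap.ker p →ₗ[R] M) :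
      Nat.card {θ : X →ₗ[R] Pushout η // Function.Surjective θ} =
        ∑ φ : {φ : X →ₗ[R] F // Function.Surjective φ},
          Nat.card {q : (LinearMap.ker φ.1 →ₗ[R] M) × (Q →ₗ[R] M) // Function.Surjective q.1 ∧
            q.1 ∘ₗ kerMap (hs φ) - q.2 ∘ₗ (LinearMap.ker p).subtype = η} := by
    have := Pushout.finite η
    rw [natCard_surjective_eq_sum_lifts (Pushout.proj_surjective η hp)]
    exact Finset.sum_congr rfl fun φ _ => natCard_surjective_lifts hp φ.2 (hs φ)
      (Pushout.inr_injective η) (Pushout.exact_inr_proj η) (Pushout.proj_comp_inl η)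
      (Pushout.inl_comp_subtype η)
  rw [Finset.sum_congr rfl fun η _ => hlifts η, Finset.sum_comm, Finset.sum_mul]
  refine Finset.sum_congr rfl fun φ _ => ?_
  rw [sum_natCard_fiber (fun ψ : LinearMap.ker φ.1 →ₗ[R] M => Function.Surjective ψ) fun q =>
    q.1 ∘ₗ kerMap (hs φ) - q.2 ∘ₗ (LinearMap.ker p).subtype, Nat.card_prod]

end Pushout

end Extensions

section Surjections

variable {R : Type*} [Ring R] {N M K : Type*} [AddCommGroup N] [Module R N]
  [AddCommGroup M] [Module R M] [AddCommGroup K] [Module R K]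

theorem surjective_prod_iff [IsSimpleModule R K] {f : N →ₗ[R] K} {ψ : N →ₗ[R] M} :
    Function.Surjective (f.prod ψ) ↔
      Function.Surjective ψ ∧ ¬ LinearMap.ker ψ ≤ LinearMap.ker f := by
  have := IsSimpleModule.nontrivial R K
  constructor
  · intro h
    refine ⟨Prod.snd_surjective.comp h, fun hle => ?_⟩
    obtain ⟨k, hk⟩ := exists_ne (0 : K)
    obtain ⟨x, hx⟩ := h (k, 0)
    obtain ⟨hfx : f x = k, hψx : ψ x = 0⟩ := Prod.mk.inj hx
    exact hk (hfx.symm.trans (hle hψx))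
  · rintro ⟨hψ, hle⟩ ⟨k, m⟩
    obtain ⟨x, rfl⟩ := hψ m
    have hf : f ∘ₗ (LinearMap.ker ψ).subtype ≠ 0 := fun h => hle fun z hz =>
      LinearMap.congr_fun h ⟨z, hz⟩
    obtain ⟨z, hz : f z = k - f x⟩ := LinearMap.surjective_of_ne_zero hf (k - f x)
    have hfx : f (x + z) = k := by rw [map_add, hz, add_sub_cancel]
    have hψx : ψ (x + z) = ψ x := by rw [map_add, z.2, add_zero]
    exact ⟨x + z, Prod.ext hfx hψx⟩

theorem natCard_hom_ker_le {ψ : N →ₗ[R] M} (hψ : Function.Surjective ψ) :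
    Nat.card {f : N →ₗ[R] K // LinearMap.ker ψ ≤ LinearMap.ker f} = Nat.card (M →ₗ[R] K) := by
  refine (Nat.card_congr (Equiv.ofBijective
    (fun g : M →ₗ[R] K => ⟨g ∘ₗ ψ, LinearMap.ker_le_ker_comp ψ g⟩) ⟨?_, ?_⟩)).symm
  · exact fun g g' h => (LinearMap.cancel_right hψ).mp (congrArg Subtype.val h)
  · rintro ⟨f, hf⟩
    obtain ⟨g, hg⟩ := exists_comp_eq_of_ker_le hψ f hf
    exact ⟨g, Subtype.ext hg⟩

theorem natCard_hom_not_ker_le [Finite N] [Finite K] {ψ : N →ₗ[R] M}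
    (hψ : Function.Surjective ψ) :
    (Nat.card {f : N →ₗ[R] K // ¬ LinearMap.ker ψ ≤ LinearMap.ker f} : ℝ) =
      Nat.card (N →ₗ[R] K) - Nat.card (M →ₗ[R] K) := by
  classical
  rw [eq_sub_iff_add_eq', ← natCard_hom_ker_le hψ, ← Nat.cast_add, ← Nat.card_sum,
    Nat.card_congr (Equiv.sumCompl fun f : N →ₗ[R] K => LinearMap.ker ψ ≤ LinearMap.ker f)]

theorem natCard_surjective_prod [IsSimpleModule R K] [Finite N] [Finite K] [Finite M] :
    (Nat.card {θ : N →ₗ[R] K × M // Function.Surjective θ} : ℝ) =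
      Nat.card {ψ : N →ₗ[R] M // Function.Surjective ψ} *
        ((Nat.card (N →ₗ[R] K) : ℝ) - Nat.card (M →ₗ[R] K)) := by
  have := Fintype.ofFinite {ψ : N →ₗ[R] M // Function.Surjective ψ}
  let components : {θ : N →ₗ[R] K × M // Function.Surjective θ} ≃
      Σ ψ : {ψ : N →ₗ[R] M // Function.Surjective ψ},
        {f : N →ₗ[R] K // ¬ LinearMap.ker ψ.1 ≤ LinearMap.ker f} :=
    { toFun := fun θ =>
        have hθ := surjective_prod_iff (f := LinearMap.fst R K M ∘ₗ θ.1)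
          (ψ := LinearMap.snd R K M ∘ₗ θ.1) |>.mp θ.2
        ⟨⟨LinearMap.snd R K M ∘ₗ θ.1, hθ.1⟩, LinearMap.fst R K M ∘ₗ θ.1, hθ.2⟩
      invFun := fun q => ⟨q.2.1.prod q.1.1, surjective_prod_iff.mpr ⟨q.1.2, q.2.2⟩⟩
      left_inv := fun _ => rfl
      right_inv := fun _ => rfl }
  rw [Nat.card_congr components, Nat.card_sigma, Nat.cast_sum,
    Finset.sum_congr rfl fun ψ _ => natCard_hom_not_ker_le ψ.2, Finset.sum_const,
    Finset.card_univ, nsmul_eq_mul, ← Nat.card_eq_fintype_card]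

end Surjections

section SemisimpleModules

variable {R : Type*} [Ring R] {ι : Type*} (K : ι → FiniteModule R)

/-- The direct sum of the modules `K i`, for `i` in a list: when the `K i` represent the simple
modules, these are the semisimple modules. -/
def sumOfList : List ι → FiniteModule R
  | [] => ⟨PUnit⟩
  | i :: l => ⟨K i × sumOfList l⟩

theorem natCard_hom_sumOfList {Q : Type*} [AddCommGroup Q] [Module R Q] (l : List ι) :
    Nat.card (Q →ₗ[R] sumOfList K l) = (l.map fun i => Nat.card (Q →ₗ[R] K i)).prod := by
  induction l with
  | nil =>
    have : Unique (Q →ₗ[R] sumOfList K []) := inferInstanceAs (Unique (Q →ₗ[R] PUnit))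
    rw [Nat.card_unique, List.map_nil, List.prod_nil]
  | cons i l ih =>
    rw [List.map_cons, List.prod_cons, ← ih, ← Nat.card_prod]
    exact Nat.card_congr (LinearMap.prodEquiv (R := R) (M := Q) (M₂ := K i)
      (M₃ := sumOfList K l) ℕ).symm.toEquiv

variable {K} [DecidableEq ι]

theorem natCard_hom_of_sumOfList (hK : ∀ i, IsSimpleModule R (K i))
    (hne : ∀ i j, Iso (K i) (K j) → i = j) (l : List ι) (i : ι) :
    Nat.card (sumOfList K l →ₗ[R] K i) = Nat.card (Module.End R (K i)) ^ l.count i := by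
  induction l with
  | nil =>
    have : Unique (sumOfList K [] →ₗ[R] K i) := inferInstanceAs (Unique (PUnit →ₗ[R] K i))
    rw [Nat.card_unique, List.count_nil, pow_zero]
  | cons j l ih =>
    have hcons : Nat.card (sumOfList K (j :: l) →ₗ[R] K i) =
        Nat.card (K j →ₗ[R] K i) * Nat.card (sumOfList K l →ₗ[R] K i) := by
      rw [← Nat.card_prod]
      exact Nat.card_congr (LinearMap.coprodEquiv (R := R) (M := K j) (M₂ := sumOfList K l)
        (M₃ := K i) ℕ).symm.toEquiv
    rw [hcons, ih, List.count_cons]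
    by_cases hij : j = i
    · subst hij
      rw [beq_self_eq_true, if_pos rfl, pow_succ']
    · have hzero (f : K j →ₗ[R] K i) : f = 0 := by
        have := hK i
        have := hK j
        exact (LinearMap.bijective_or_eq_zero f).resolve_left fun hf =>
          hij (hne j i ⟨LinearEquiv.ofBijective f hf⟩)
      have : Unique (K j →ₗ[R] K i) := ⟨⟨0⟩, hzero⟩
      rw [Nat.card_unique, one_mul, if_neg (by simpa using hij), add_zero]

theorem prod_range_count_cons [Fintype ι] (f : ι → ℕ → ℝ) (i : ι) (l : List ι) :
    ∏ k, ∏ j ∈ Finset.range ((i :: l).count k), f k j =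
      (∏ k, ∏ j ∈ Finset.range (l.count k), f k j) * f i (l.count i) := by
  have hfactor (k : ι) : ∏ j ∈ Finset.range ((i :: l).count k), f k j =
      (∏ j ∈ Finset.range (l.count k), f k j) * if k = i then f i (l.count i) else 1 := by
    by_cases hk : k = i
    · subst hk
      rw [List.count_cons_self, Finset.prod_range_succ, if_pos rfl]
    · rw [List.count_cons_of_ne (Ne.symm hk), if_neg hk, mul_one]
  rw [Finset.prod_congr rfl fun k _ => hfactor k, Finset.prod_mul_distrib, Finset.prod_ite_eq',
    if_pos (Finset.mem_univ i)]

theorem natCard_surjective_sumOfList (hK : ∀ i, IsSimpleModule R (K i))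
    (hne : ∀ i j, Iso (K i) (K j) → i = j) [Fintype ι] {N : Type*} [AddCommGroup N] [Module R N]
    [Finite N] (l : List ι) :
    (Nat.card {θ : N →ₗ[R] sumOfList K l // Function.Surjective θ} : ℝ) =
      ∏ i, ∏ j ∈ Finset.range (l.count i),
        ((Nat.card (N →ₗ[R] K i) : ℝ) - (Nat.card (Module.End R (K i)) : ℝ) ^ j) := by
  induction l with
  | nil =>
    have : Subsingleton (sumOfList K []) := inferInstanceAs (Subsingleton PUnit)
    have : Unique {θ : N →ₗ[R] sumOfList K [] // Function.Surjective θ} :=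
      ⟨⟨0, Function.surjective_to_subsingleton _⟩, fun _ => Subsingleton.elim _ _⟩
    simp
  | cons i l ih =>
    have := hK i
    have hprod := natCard_surjective_prod (R := R) (N := N) (K := K i) (M := sumOfList K l)
    rw [ih, natCard_hom_of_sumOfList hK hne, Nat.cast_pow] at hprod
    rw [prod_range_count_cons (fun i j =>
      (Nat.card (N →ₗ[R] K i) : ℝ) - (Nat.card (Module.End R (K i)) : ℝ) ^ j)]
    exact hprod

end SemisimpleModules

section Sieve

/-- The product `∏_{j < d} (Q - q ^ j) / (q ^ (j + 1) - 1)`. For `Q = q ^ r` it is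
`q ^ (d.choose 2)` times the number of `d`-dimensional subspaces of an `r`-dimensional space over
the field with `q` elements, that is, up to the sign `(-1) ^ d`, the contribution of these
subspaces to Möbius inversion on the lattice of subspaces. -/
def sieveTerm (q Q : ℝ) (d : ℕ) : ℝ := ∏ j ∈ Finset.range d, (Q - q ^ j) / (q ^ (j + 1) - 1)

/-- The alternating partial sums of `sieveTerm`. -/
def sieveSum (q Q : ℝ) (D : ℕ) : ℝ := ∑ d ∈ Finset.range (D + 1), (-1) ^ d * sieveTerm q Q d

variable {q : ℝ}

theorem pow_succ_sub_one_pos (hq : 1 < q) (j : ℕ) : 0 < q ^ (j + 1) - 1 :=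
  sub_pos.mpr (one_lt_pow₀ hq (Nat.succ_ne_zero j))

theorem sieveTerm_zero (q Q : ℝ) : sieveTerm q Q 0 = 1 :=
  Finset.prod_range_zero _

theorem sieveTerm_succ (q Q : ℝ) (d : ℕ) :
    sieveTerm q Q (d + 1) = (Q - 1) / (q ^ (d + 1) - 1) *
      ∏ j ∈ Finset.range d, (Q - q ^ (j + 1)) / (q ^ (j + 1) - 1) := by
  rw [sieveTerm, Finset.prod_div_distrib, Finset.prod_range_succ', Finset.prod_range_succ,
    Finset.prod_div_distrib, pow_zero, mul_comm, mul_comm (∏ j ∈ Finset.range d, _),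
    mul_div_mul_comm]

theorem sieveSum_succ (q Q : ℝ) (D : ℕ) :
    sieveSum q Q (D + 1) = sieveSum q Q D + (-1) ^ (D + 1) * sieveTerm q Q (D + 1) :=
  Finset.sum_range_succ _ _

theorem sieveSum_eq_prod (hq : 1 < q) (Q : ℝ) (D : ℕ) :
    sieveSum q Q D = ∏ j ∈ Finset.range D, -((Q - q ^ (j + 1)) / (q ^ (j + 1) - 1)) := by
  induction D with
  | zero => simp [sieveSum, sieveTerm]
  | succ D ih =>
    rw [sieveSum_succ, ih, sieveTerm_succ, Finset.prod_range_succ, Finset.prod_neg,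
      Finset.card_range]
    have := (pow_succ_sub_one_pos hq D).ne'
    field_simp
    ring

theorem pow_sub_pow_div_nonneg (hq : 1 < q) {r i : ℕ} (hi : i ≤ r) (j : ℕ) :
    0 ≤ (q ^ r - q ^ i) / (q ^ (j + 1) - 1) :=
  div_nonneg (sub_nonneg.mpr (pow_le_pow_right₀ hq.le hi)) (pow_succ_sub_one_pos hq j).le

theorem sieveTerm_nonneg (hq : 1 < q) (r d : ℕ) : 0 ≤ sieveTerm q (q ^ r) d := by
  rcases lt_or_ge r d with h | h
  · rw [sieveTerm, Finset.prod_eq_zero (Finset.mem_range.mpr h) (by simp)]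
  · exact Finset.prod_nonneg fun j hj =>
      pow_sub_pow_div_nonneg hq ((Finset.mem_range.mp hj).le.trans h) j

theorem sieveSum_one (hq : 1 < q) (D : ℕ) : sieveSum q 1 D = 1 := by
  rw [sieveSum_eq_prod hq]
  refine Finset.prod_eq_one fun j _ => ?_
  rw [← neg_div, neg_sub, div_self (pow_succ_sub_one_pos hq j).ne']

theorem sieveSum_pow_eq_zero (hq : 1 < q) {r D : ℕ} (hr : r ≠ 0) (hrD : r ≤ D) :
    sieveSum q (q ^ r) D = 0 := by
  obtain ⟨r, rfl⟩ := Nat.exists_eq_succ_of_ne_zero hr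
  rw [sieveSum_eq_prod hq]
  exact Finset.prod_eq_zero (Finset.mem_range.mpr hrD) (by simp)

theorem abs_sieveSum_pow_le (hq : 1 < q) {r D : ℕ} (hrD : D < r) :
    |sieveSum q (q ^ r) D| ≤ sieveTerm q (q ^ r) (D + 1) := by
  have hnonneg : ∀ j ∈ Finset.range D, 0 ≤ (q ^ r - q ^ (j + 1)) / (q ^ (j + 1) - 1) :=
    fun j hj => pow_sub_pow_div_nonneg hq ((Finset.mem_range.mp hj).trans hrD) j
  rw [sieveSum_eq_prod hq, sieveTerm_succ, Finset.abs_prod,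
    Finset.prod_congr rfl fun j hj => (abs_neg _).trans (abs_of_nonneg (hnonneg j hj))]
  refine le_mul_of_one_le_left (Finset.prod_nonneg hnonneg) ?_
  rw [one_le_div (pow_succ_sub_one_pos hq D)]
  exact sub_le_sub_right (pow_le_pow_right₀ hq.le hrD) 1

theorem abs_indicator_sub_sieveSum_le (hq : 1 < q) (r D : ℕ) :
    |(if r = 0 then 1 else 0) - sieveSum q (q ^ r) D| ≤ sieveTerm q (q ^ r) (D + 1) := by
  rcases eq_or_ne r 0 with rfl | hr
  · rw [if_pos rfl, pow_zero, sieveSum_one hq, sub_self, abs_zero, ← pow_zero q]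
    exact sieveTerm_nonneg hq 0 (D + 1)
  rw [if_neg hr, zero_sub, abs_neg]
  rcases le_or_gt r D with hrD | hrD
  · rw [sieveSum_pow_eq_zero hq hr hrD, abs_zero]
    exact sieveTerm_nonneg hq r (D + 1)
  · exact abs_sieveSum_pow_le hq hrD

section Products

variable {ι : Type*} (s : Finset ι) {a b ε : ι → ℝ}

theorem abs_prod_le_prod_one_add (hb : ∀ i ∈ s, |b i| ≤ 1) (h : ∀ i ∈ s, |b i - a i| ≤ ε i) :
    |∏ i ∈ s, a i| ≤ ∏ i ∈ s, (1 + ε i) := by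
  rw [Finset.abs_prod]
  refine Finset.prod_le_prod (fun i _ => abs_nonneg _) fun i hi => ?_
  calc |a i| ≤ |b i| + |b i - a i| := by
        linarith [abs_sub_abs_le_abs_sub (a i) (b i), abs_sub_comm (a i) (b i)]
    _ ≤ 1 + ε i := add_le_add (hb i hi) (h i hi)

theorem abs_prod_sub_prod_le (hb : ∀ i ∈ s, |b i| ≤ 1) (h : ∀ i ∈ s, |b i - a i| ≤ ε i) :
    |∏ i ∈ s, b i - ∏ i ∈ s, a i| ≤ ∏ i ∈ s, (1 + ε i) - 1 := by
  classical
  induction s using Finset.induction_on with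
  | empty => simp
  | insert i s hi ih =>
    have hbs : ∀ j ∈ s, |b j| ≤ 1 := fun j hj => hb j (Finset.mem_insert_of_mem hj)
    have hs : ∀ j ∈ s, |b j - a j| ≤ ε j := fun j hj => h j (Finset.mem_insert_of_mem hj)
    have hbi := hb i (Finset.mem_insert_self i s)
    have hi' := h i (Finset.mem_insert_self i s)
    rw [Finset.prod_insert hi, Finset.prod_insert hi, Finset.prod_insert hi]
    calc |b i * ∏ j ∈ s, b j - a i * ∏ j ∈ s, a j|
        = |b i * (∏ j ∈ s, b j - ∏ j ∈ s, a j) + (b i - a i) * ∏ j ∈ s, a j| := by ring_nf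
      _ ≤ |b i| * |∏ j ∈ s, b j - ∏ j ∈ s, a j| + |b i - a i| * |∏ j ∈ s, a j| := by
        rw [← abs_mul, ← abs_mul]
        exact abs_add_le _ _
      _ ≤ 1 * (∏ j ∈ s, (1 + ε j) - 1) + ε i * ∏ j ∈ s, (1 + ε j) := by
        gcongr
        · exact ih hbs hs
        · exact (abs_nonneg _).trans hi'
        · exact abs_prod_le_prod_one_add s hbs hs
      _ = (1 + ε i) * ∏ j ∈ s, (1 + ε j) - 1 := by ring

end Products

/-- The product `∏_{j < d} x / (q ^ (j + 1) - 1)`: the limiting expectation of the `sieveTerm` of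
the kernel of a surjection at a simple module with endomorphism field of cardinality `q` and
weight `1 / x`. -/
def limitTerm (q x : ℝ) (d : ℕ) : ℝ := ∏ j ∈ Finset.range d, x / (q ^ (j + 1) - 1)

variable {x : ℝ}

theorem limitTerm_zero (q x : ℝ) : limitTerm q x 0 = 1 :=
  Finset.prod_range_zero _

theorem limitTerm_succ (q x : ℝ) (d : ℕ) :
    limitTerm q x (d + 1) = limitTerm q x d * (x / (q ^ (d + 1) - 1)) :=
  Finset.prod_range_succ _ _

theorem limitTerm_pos (hq : 1 < q) (hx : 0 < x) (d : ℕ) : 0 < limitTerm q x d :=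
  Finset.prod_pos fun j _ => div_pos hx (pow_succ_sub_one_pos hq j)

theorem div_pow_succ_sub_one_le (hq : 2 ≤ q) (hx : x ≤ 1) (d : ℕ) :
    x / (q ^ (d + 1) - 1) ≤ (1 / 2) ^ d := by
  have hpow : (2 : ℝ) ^ d ≤ q ^ (d + 1) - 1 := by
    have h2 : (2 : ℝ) ^ (d + 1) ≤ q ^ (d + 1) := pow_le_pow_left₀ zero_le_two hq _
    have h1 : (1 : ℝ) ≤ 2 ^ d := one_le_pow₀ one_le_two
    rw [pow_succ] at h2
    linarith
  rw [one_div_pow]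
  exact div_le_div₀ zero_le_one hx (by positivity) hpow

theorem limitTerm_succ_le (hq : 2 ≤ q) (hx : 0 < x) (hx1 : x ≤ 1) (d : ℕ) :
    limitTerm q x (d + 1) ≤ limitTerm q x d * (1 / 2) ^ d := by
  rw [limitTerm_succ]
  exact mul_le_mul_of_nonneg_left (div_pow_succ_sub_one_le hq hx1 d)
    (limitTerm_pos (by linarith) hx d).le

theorem limitTerm_antitone (hq : 2 ≤ q) (hx : 0 < x) (hx1 : x ≤ 1) :
    Antitone (limitTerm q x) :=
  antitone_nat_of_succ_le fun d => (limitTerm_succ_le hq hx hx1 d).trans <|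
    mul_le_of_le_one_right (limitTerm_pos (by linarith) hx d).le
      (pow_le_one₀ (by norm_num) (by norm_num))

theorem tendsto_limitTerm (hq : 2 ≤ q) (hx : 0 < x) (hx1 : x ≤ 1) :
    Tendsto (limitTerm q x) atTop (𝓝 0) := by
  have hle (d : ℕ) : limitTerm q x (d + 1) ≤ (1 / 2) ^ d := by
    have hle_one : limitTerm q x d ≤ 1 :=
      limitTerm_zero q x ▸ limitTerm_antitone hq hx hx1 (Nat.zero_le d)
    exact (limitTerm_succ_le hq hx hx1 d).trans (mul_le_of_le_one_left (by positivity) hle_one)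
  rw [← tendsto_add_atTop_iff_nat 1]
  exact squeeze_zero (fun d => (limitTerm_pos (by linarith) hx _).le) hle
    (tendsto_pow_atTop_nhds_zero_of_lt_one (by norm_num) (by norm_num))

theorem exists_pos_tendsto_sum_limitTerm (hq : 2 ≤ q) (hx : 0 < x) (hx1 : x ≤ 1) :
    ∃ c : ℝ, 0 < c ∧
      Tendsto (fun D => ∑ d ∈ Finset.range (D + 1), (-1) ^ d * limitTerm q x d) atTop (𝓝 c) := by
  have hanti := limitTerm_antitone hq hx hx1
  obtain ⟨c, hc⟩ :=
    hanti.tendsto_alternating_series_of_tendsto_zero (tendsto_limitTerm hq hx hx1)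
  refine ⟨c, ?_, (tendsto_add_atTop_iff_nat 1).mpr hc⟩
  have hc_ge := hanti.alternating_series_le_tendsto hc 2
  have h01 : limitTerm q x 1 ≤ limitTerm q x 0 := hanti zero_le_one
  have h23 := limitTerm_succ_le hq hx hx1 2
  have h2 := limitTerm_pos (by linarith : 1 < q) hx 2
  norm_num [Finset.sum_range_succ] at hc_ge h01 h23
  linarith

end Sieve

universe u

section FiniteModules

variable {R : Type u} [Ring R]

section OfFinite

variable (R) (E : Type*) [AddCommGroup E] [Module R E] [Finite E]

/-- A copy in `Type` of a finite module, which makes it a `FiniteModule`. -/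
def ofFinite : FiniteModule R :=
  ⟨Shrink.{0} E⟩

variable {R}

/-- The identification of `ofFinite R E` with `E`. -/
def ofFiniteEquiv : ofFinite R E ≃ₗ[R] E :=
  Equiv.linearEquiv R (equivShrink.{0} E).symm

end OfFinite

theorem Iso.symm {G H : FiniteModule R} (h : Iso G H) : Iso H G :=
  h.map LinearEquiv.symm

theorem Iso.trans {G H L : FiniteModule R} (h : Iso G H) (h' : Iso H L) : Iso G L :=
  ⟨h.some.trans h'.some⟩

theorem isoClass_eq_iff {G H : FiniteModule R} : isoClass G = isoClass H ↔ Iso G H :=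
  Quotient.eq (r := isoSetoid R)

theorem isoClass_rep (c : IsoClass R) : isoClass c.rep = c :=
  Quotient.out_eq _

theorem iso_rep_isoClass (G : FiniteModule R) : Iso (isoClass G).rep G :=
  isoClass_eq_iff.mp (isoClass_rep _)

theorem finite_setOf_exists_surjective (B : Type*) [AddCommGroup B] [Module R B] [Finite B] :
    {c : IsoClass R | ∃ f : B →ₗ[R] c.rep, Function.Surjective f}.Finite := by
  have : Finite (Submodule R B) := .of_injective _ SetLike.coe_injective
  have (N : Submodule R B) : Finite (B ⧸ N) := .of_surjective _ N.mkQ_surjective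
  refine (Set.finite_range fun N : Submodule R B => isoClass (ofFinite R (B ⧸ N))).subset ?_
  rintro c ⟨f, hf⟩
  exact ⟨LinearMap.ker f, (isoClass_eq_iff.mpr
    ⟨(ofFiniteEquiv _).trans (f.quotKerEquivOfSurjective hf)⟩).trans (isoClass_rep c)⟩

theorem exists_surjective_of_span_eq_top {X : Type*} [AddCommGroup X] [Module R X] {d : ℕ}
    {v : Fin d → X} (hv : Submodule.span R (Set.range v) = ⊤) :
    ∃ f : (Fin d → R) →ₗ[R] X, Function.Surjective f :=
  ⟨Fintype.linearCombination R v, by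
    rw [← LinearMap.range_eq_top, Fintype.range_linearCombination, hv]⟩

theorem exists_span_eq_top_cons {X : Type*} [AddCommGroup X] [Module R X] {x : X} {k : ℕ}
    {v : Fin k → X ⧸ Submodule.span R {x}} (hv : Submodule.span R (Set.range v) = ⊤) :
    ∃ w : Fin (k + 1) → X, Submodule.span R (Set.range w) = ⊤ := by
  let N := Submodule.span R {x}
  choose w hw using fun j => N.mkQ_surjective (v j)
  have hmap : (Submodule.span R (Set.range w)).map N.mkQ = ⊤ := by
    rw [Submodule.map_span, ← Set.range_comp, ← hv, ← funext hw, Function.comp_def]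
  refine ⟨Fin.cons x w, ?_⟩
  rw [Fin.range_cons, Submodule.span_insert]
  exact (Submodule.map_mkQ_eq_top N _).mp hmap

theorem exists_surjective_of_finite (X : Type*) [AddCommGroup X] [Module R X] [Finite X] :
    ∃ f : (Fin (Nat.card X) → R) →ₗ[R] X, Function.Surjective f :=
  exists_surjective_of_span_eq_top (v := (Finite.equivFin X).symm) (by
    rw [(Finite.equivFin X).symm.surjective.range_eq, Submodule.span_univ])

variable (R) in
/-- The properties of a maximal `ℤ_S`-order on which the moment problem depends: quotients of
finitely generated modules by nonzero integers are finite, submodules of finite index of a free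
module have as many homomorphisms to a simple module as the free module itself, and some nonzero
integer lies in the Jacobson radical, in the sense that it kills the finite simple modules and
satisfies Nakayama's lemma for finite modules. -/
structure IsCohenLenstraRing : Prop where
  finite_of_zsmul_eq_zero : ∀ n : ℤ, n ≠ 0 → ∀ (Y : Type u) [AddCommGroup Y] [Module R Y]
    [Module.Finite R Y], (∀ y : Y, n • y = 0) → Finite Y
  natCard_hom_eq : ∀ K : FiniteModule R, IsSimpleModule R K →
    ∀ (d : ℕ) (N : Submodule R (Fin d → R)), Finite ((Fin d → R) ⧸ N) →
      Nat.card (N →ₗ[R] K) = Nat.card ((Fin d → R) →ₗ[R] K)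
  exists_radical : ∃ a : ℤ, a ≠ 0 ∧
    (∀ K : FiniteModule R, IsSimpleModule R K → ∀ k : K, a • k = 0) ∧
    ∀ Y : FiniteModule R, (∀ y : Y, ∃ y' : Y, a • y' = y) → Subsingleton Y

theorem IsCohenLenstraRing.finite_isoClass (hR : IsCohenLenstraRing R) {n : ℤ} (hn : n ≠ 0)
    (d : ℕ) : {c : IsoClass R | (∃ f : (Fin d → R) →ₗ[R] c.rep, Function.Surjective f) ∧
      ∀ x : c.rep, n • x = 0}.Finite := by
  let N : Submodule R (Fin d → R) := LinearMap.range (n • LinearMap.id (R := R))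
  have : Finite ((Fin d → R) ⧸ N) := by
    refine hR.finite_of_zsmul_eq_zero n hn _ fun y => ?_
    obtain ⟨x, rfl⟩ := Submodule.Quotient.mk_surjective _ y
    rw [← Submodule.Quotient.mk_smul, Submodule.Quotient.mk_eq_zero]
    exact ⟨x, rfl⟩
  refine (finite_setOf_exists_surjective ((Fin d → R) ⧸ N)).subset ?_
  rintro c ⟨⟨f, hf⟩, hc⟩
  have hle : N ≤ LinearMap.ker f := by
    rintro _ ⟨x, rfl⟩
    rw [LinearMap.mem_ker, LinearMap.smul_apply, map_zsmul, hc]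
  exact ⟨N.liftQ f hle, .of_comp (g := N.mkQ) (by rwa [← LinearMap.coe_comp, N.liftQ_mkQ])⟩

theorem IsCohenLenstraRing.countable_isoClass (hR : IsCohenLenstraRing R) :
    Countable (IsoClass R) := by
  rw [← Set.countable_univ_iff]
  refine (Set.countable_iUnion fun n : ℕ =>
    (hR.finite_isoClass (n := (n + 1 : ℕ)) (by positivity) (n + 1)).countable).mono fun c _ => ?_
  have hpos : 0 < Nat.card c.rep := Nat.card_pos
  refine Set.mem_iUnion.mpr ⟨Nat.card c.rep - 1, ?_⟩
  rw [Nat.sub_add_cancel hpos]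
  exact ⟨exists_surjective_of_finite _,
    fun x => by rw [natCast_zsmul]; exact card_nsmul_eq_zero'⟩

variable (R) in
/-- The isomorphism classes of finite simple modules. -/
abbrev SimpleClass := {c : IsoClass R // IsSimpleModule R c.rep}

/-- A chosen representative of an isomorphism class of finite simple modules. -/
def SimpleClass.rep (i : SimpleClass R) : FiniteModule R :=
  i.1.rep

instance SimpleClass.isSimpleModule (i : SimpleClass R) : IsSimpleModule R i.rep :=
  i.2

theorem SimpleClass.eq_of_iso (i j : SimpleClass R) (h : Iso i.rep j.rep) : i = j :=
  Subtype.ext (by rw [← isoClass_rep i.1, ← isoClass_rep j.1]; exact isoClass_eq_iff.mpr h)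

theorem exists_simpleClass (K : Type*) [AddCommGroup K] [Module R K] [Finite K]
    [IsSimpleModule R K] : ∃ i : SimpleClass R, Nonempty (K ≃ₗ[R] i.rep) := by
  obtain ⟨f⟩ := iso_rep_isoClass (ofFinite R K)
  let g := f.trans (ofFiniteEquiv K)
  exact ⟨⟨isoClass (ofFinite R K), IsSimpleModule.congr g⟩, ⟨g.symm⟩⟩

theorem exists_surjective_simpleClass (X : Type*) [AddCommGroup X] [Module R X] [Finite X]
    [Nontrivial X] : ∃ (i : SimpleClass R) (f : X →ₗ[R] i.rep), Function.Surjective f := by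
  obtain ⟨m, hm⟩ := IsCoatomic.exists_coatom (Submodule R X)
  have : IsSimpleModule R (X ⧸ m) := isSimpleModule_iff_isCoatom.mpr hm
  have : Finite (X ⧸ m) := .of_surjective _ m.mkQ_surjective
  obtain ⟨i, ⟨g⟩⟩ := exists_simpleClass (R := R) (X ⧸ m)
  exact ⟨i, g.toLinearMap ∘ₗ m.mkQ, g.surjective.comp m.mkQ_surjective⟩

theorem IsCohenLenstraRing.finite_simpleClass (hR : IsCohenLenstraRing R) :
    Finite (SimpleClass R) := by
  obtain ⟨a, ha, hkill, -⟩ := hR.exists_radical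
  refine Set.Finite.to_subtype ((hR.finite_isoClass ha 1).subset fun c hc => ?_)
  have hsimple : IsSimpleModule R c.rep := hc
  have := IsSimpleModule.nontrivial R c.rep
  obtain ⟨x, hx⟩ := exists_ne (0 : c.rep)
  refine ⟨exists_surjective_of_span_eq_top (v := fun _ => x) ?_, hkill _ hsimple⟩
  rw [Set.range_const]
  exact IsSimpleModule.span_singleton_eq_top R hx

theorem natCard_hom_le_of_surjective {X Y K : Type*} [AddCommGroup X] [Module R X]
    [AddCommGroup Y] [Module R Y] [AddCommGroup K] [Module R K] [Finite X] [Finite K]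
    {ψ : X →ₗ[R] Y} (hψ : Function.Surjective ψ) :
    Nat.card (Y →ₗ[R] K) ≤ Nat.card (X →ₗ[R] K) := by
  rw [← natCard_hom_ker_le hψ]
  exact Finite.card_subtype_le _

section HomCount

variable [Fintype (SimpleClass R)] {X Y : Type*} [AddCommGroup X] [Module R X]
  [AddCommGroup Y] [Module R Y]

variable (R) in
/-- The total number of homomorphisms from a module to the finite simple modules. It controls the
number of generators, by `exists_span_eq_top_of_homCount_le`. -/
def homCount (X : Type*) [AddCommGroup X] [Module R X] : ℕ :=
  ∑ i : SimpleClass R, Nat.card (X →ₗ[R] i.rep)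

theorem homCount_le_of_surjective [Finite X] {ψ : X →ₗ[R] Y} (hψ : Function.Surjective ψ) :
    homCount R Y ≤ homCount R X :=
  Finset.sum_le_sum fun _ _ => natCard_hom_le_of_surjective hψ

variable (R) in
theorem homCount_pos [Finite X] [Nontrivial X] : 0 < homCount R X := by
  obtain ⟨i, -⟩ := exists_surjective_simpleClass (R := R) X
  exact Finset.sum_pos (fun _ _ => Nat.card_pos) ⟨i, Finset.mem_univ i⟩

variable (R) in
theorem exists_homCount_quotient_span_lt [Finite X] [Nontrivial X] :
    ∃ x : X, homCount R (X ⧸ Submodule.span R {x}) < homCount R X := by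
  obtain ⟨i, f, hf⟩ := exists_surjective_simpleClass (R := R) X
  have := IsSimpleModule.nontrivial R i.rep
  obtain ⟨k, hk⟩ := exists_ne (0 : i.rep)
  obtain ⟨x, rfl⟩ := hf k
  have hx := (Submodule.span R {x}).mkQ_surjective
  refine ⟨x, Finset.sum_lt_sum (fun j _ => natCard_hom_le_of_surjective hx)
    ⟨i, Finset.mem_univ _, ?_⟩⟩
  rw [← natCard_hom_ker_le hx]
  refine Finite.card_subtype_lt (x := f) fun hle => hk (hle ?_)
  rw [Submodule.ker_mkQ]
  exact Submodule.mem_span_singleton_self x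

theorem exists_span_eq_top_of_homCount_le (k : ℕ) (X : Type*) [AddCommGroup X] [Module R X]
    [Finite X] (hk : homCount R X ≤ k) :
    ∃ v : Fin k → X, Submodule.span R (Set.range v) = ⊤ := by
  induction k generalizing X with
  | zero =>
    rcases subsingleton_or_nontrivial X with _ | _
    · exact ⟨Fin.elim0, Subsingleton.elim _ _⟩
    · exact absurd hk (homCount_pos R).not_ge
  | succ k ih =>
    rcases subsingleton_or_nontrivial X with _ | _
    · exact ⟨fun _ => 0, Subsingleton.elim _ _⟩
    · obtain ⟨x, hx⟩ := exists_homCount_quotient_span_lt R (X := X)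
      have : Finite (X ⧸ Submodule.span R {x}) := .of_surjective _ (Submodule.mkQ_surjective _)
      obtain ⟨v, hv⟩ := ih (X ⧸ Submodule.span R {x}) (by omega)
      exact exists_span_eq_top_cons hv

theorem IsCohenLenstraRing.finite_homCount_le (hR : IsCohenLenstraRing R) {n : ℤ} (hn : n ≠ 0)
    (T : ℕ) : {c : IsoClass R | homCount R c.rep ≤ T ∧ ∀ x : c.rep, n • x = 0}.Finite :=
  (hR.finite_isoClass hn T).subset fun c hc => by
    obtain ⟨v, hv⟩ := exists_span_eq_top_of_homCount_le T c.rep hc.1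
    exact ⟨exists_surjective_of_span_eq_top hv, hc.2⟩

end HomCount

end FiniteModules

section Weight

variable {R : Type*} [Ring R]

/-- A weight on finite modules with values in `[1, ∞)` that is multiplicative in short exact
sequences; the abstraction of `G ↦ |G|^u` used in the moment problem. -/
structure IsWeight (W : FiniteModule R → ℝ) : Prop where
  one_le : ∀ G, 1 ≤ W G
  eq_mul_of_exact : ∀ {M E F : FiniteModule R} {ι : M →ₗ[R] E} {π : E →ₗ[R] F},
    Function.Injective ι → Function.Exact ι π → Function.Surjective π → W E = W F * W M

variable {W : FiniteModule R → ℝ}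

theorem IsWeight.pos (hW : IsWeight W) (G : FiniteModule R) : 0 < W G :=
  zero_lt_one.trans_le (hW.one_le G)

theorem IsWeight.one_div_pos (hW : IsWeight W) (G : FiniteModule R) : 0 < 1 / W G :=
  _root_.one_div_pos.mpr (hW.pos G)

theorem IsWeight.one_div_le_one (hW : IsWeight W) (G : FiniteModule R) : 1 / W G ≤ 1 :=
  (div_le_one (hW.pos G)).mpr (hW.one_le G)

theorem IsWeight.punit (hW : IsWeight W) : W ⟨PUnit⟩ = 1 := by
  have h := hW.eq_mul_of_exact (M := ⟨PUnit⟩) (E := ⟨PUnit⟩) (F := ⟨PUnit⟩) (ι := LinearMap.id)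
    (π := LinearMap.id) (fun _ _ h => h) (fun x => ⟨fun _ => ⟨x, rfl⟩, fun _ => rfl⟩)
    Function.surjective_id
  exact (mul_eq_left₀ (hW.pos _).ne').mp h.symm

theorem IsWeight.congr (hW : IsWeight W) {G H : FiniteModule R} (h : Iso G H) : W G = W H := by
  obtain ⟨f⟩ := h
  have hexact : Function.Exact (0 : PUnit →ₗ[R] G) f.toLinearMap := fun x =>
    ⟨fun hx => ⟨0, ((map_eq_zero_iff f f.injective).mp hx).symm⟩,
      by rintro ⟨_, rfl⟩; exact map_zero f⟩
  rw [hW.eq_mul_of_exact (M := ⟨PUnit⟩) (fun _ _ _ => rfl) hexact f.surjective, hW.punit, mul_one]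

theorem IsWeight.pushout (hW : IsWeight W) {Q : Type*} [AddCommGroup Q] [Module R Q]
    {F M : FiniteModule R} {p : Q →ₗ[R] F} (hp : Function.Surjective p)
    (η : LinearMap.ker p →ₗ[R] M) [Finite (Pushout η)] :
    W (ofFinite R (Pushout η)) = W F * W M := by
  let f := ofFiniteEquiv (R := R) (Pushout η)
  refine hW.eq_mul_of_exact (ι := f.symm.toLinearMap ∘ₗ Pushout.inr η)
    (π := Pushout.proj η ∘ₗ f.toLinearMap) (f.symm.injective.comp (Pushout.inr_injective η)) ?_
    ((Pushout.proj_surjective η hp).comp f.surjective)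
  intro x
  refine (Pushout.exact_inr_proj η (f x)).trans ⟨?_, ?_⟩
  · rintro ⟨m, hm⟩
    exact ⟨m, f.symm_apply_eq.mpr hm⟩
  · rintro ⟨m, hm⟩
    exact ⟨m, f.symm_apply_eq.mp hm⟩

theorem IsWeight.sumOfList (hW : IsWeight W) {ι : Type*} [Fintype ι] [DecidableEq ι]
    (K : ι → FiniteModule R) (l : List ι) :
    W (sumOfList K l) = ∏ i, W (K i) ^ l.count i := by
  suffices W (CLM.sumOfList K l) = ∏ i, ∏ _j ∈ Finset.range (l.count i), W (K i) by
    simpa only [Finset.prod_const, Finset.card_range] using this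
  induction l with
  | nil =>
    simp only [List.count_nil, Finset.range_zero, Finset.prod_empty, Finset.prod_const_one]
    exact hW.punit
  | cons i l ih =>
    rw [prod_range_count_cons fun k _ => W (K k), ← ih, mul_comm]
    exact hW.eq_mul_of_exact (E := CLM.sumOfList K (i :: l))
      (ι := LinearMap.inr R (K i) (CLM.sumOfList K l))
      (π := LinearMap.fst R (K i) (CLM.sumOfList K l))
      LinearMap.inr_injective (by exact Function.Exact.inr_fst) LinearMap.fst_surjective

end Weight

section MomentLimits

variable {R : Type*} [Ring R] {Ω : ℕ → Type*} [∀ n, MeasurableSpace (Ω n)]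
  {P : ∀ n, Measure (Ω n)} {X : ∀ n, Ω n → FiniteModule R}

variable (P X) in
/-- The expectations of `g (X n)` converge to `L`. Integrability is part of the notion, because the
integral of a function that is not integrable is `0`. -/
def MomentLimit (g : FiniteModule R → ℝ) (L : ℝ) : Prop :=
  (∀ᶠ n in atTop, Integrable (fun ω => g (X n ω)) (P n)) ∧
    Tendsto (fun n => ∫ ω, g (X n ω) ∂P n) atTop (𝓝 L)

theorem MomentLimit.const_mul {g : FiniteModule R → ℝ} {L : ℝ} (h : MomentLimit P X g L) (c : ℝ) :
    MomentLimit P X (fun G => c * g G) (c * L) :=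
  ⟨h.1.mono fun _ hn => hn.const_mul c, by
    simpa only [integral_const_mul] using h.2.const_mul c⟩

theorem MomentLimit.sum {ι : Type*} (s : Finset ι) {g : ι → FiniteModule R → ℝ} {L : ι → ℝ}
    (h : ∀ i ∈ s, MomentLimit P X (g i) (L i)) :
    MomentLimit P X (fun G => ∑ i ∈ s, g i G) (∑ i ∈ s, L i) := by
  have hintegrable : ∀ᶠ n in atTop, ∀ i ∈ s, Integrable (fun ω => g i (X n ω)) (P n) :=
    (eventually_all_finset s).mpr fun i hi => (h i hi).1
  refine ⟨hintegrable.mono fun n hn => integrable_finsetSum _ hn, ?_⟩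
  refine (tendsto_finsetSum _ fun i hi => (h i hi).2).congr' ?_
  filter_upwards [hintegrable] with n hn
  rw [integral_finsetSum _ hn]

theorem MomentLimit.add {g g' : FiniteModule R → ℝ} {L L' : ℝ} (h : MomentLimit P X g L)
    (h' : MomentLimit P X g' L') : MomentLimit P X (fun G => g G + g' G) (L + L') := by
  refine ⟨by filter_upwards [h.1, h'.1] with n hn hn' using hn.add hn', ?_⟩
  refine (h.2.add h'.2).congr' ?_
  filter_upwards [h.1, h'.1] with n hn hn'
  rw [integral_add hn hn']

theorem MomentLimit.sub {g g' : FiniteModule R → ℝ} {L L' : ℝ} (h : MomentLimit P X g L)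
    (h' : MomentLimit P X g' L') : MomentLimit P X (fun G => g G - g' G) (L - L') := by
  refine ⟨by filter_upwards [h.1, h'.1] with n hn hn' using hn.sub hn', ?_⟩
  refine (h.2.sub h'.2).congr' ?_
  filter_upwards [h.1, h'.1] with n hn hn'
  rw [integral_sub hn hn']

theorem MomentLimit.congr {g g' : FiniteModule R → ℝ} {L L' : ℝ} (h : MomentLimit P X g L)
    (hg : ∀ G, g G = g' G) (hL : L = L') : MomentLimit P X g' L' := by
  rwa [← hL, ← funext hg]

theorem measurable_of_isRandomModule [Countable (IsoClass R)] {Ω : Type*} [MeasurableSpace Ω]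
    {X : Ω → FiniteModule R} (hX : IsRandomModule X) {β : Type*} [MeasurableSpace β]
    {g : FiniteModule R → β} (hg : ∀ G H, Iso G H → g G = g H) :
    Measurable fun ω => g (X ω) := by
  intro s _
  have hpreimage : (fun ω => g (X ω)) ⁻¹' s =
      ⋃ c ∈ {c : IsoClass R | g c.rep ∈ s}, {ω | Iso (X ω) c.rep} := by
    ext ω
    simp only [Set.mem_preimage, Set.mem_iUnion, Set.mem_ofPred_eq, exists_prop]
    constructor
    · intro h
      refine ⟨isoClass (X ω), ?_, (iso_rep_isoClass _).symm⟩
      rwa [hg _ _ (iso_rep_isoClass (X ω))]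
    · rintro ⟨c, hc, h⟩
      rwa [hg _ _ h]
  rw [hpreimage]
  exact MeasurableSet.biUnion (Set.to_countable _) fun c _ => hX c.rep

theorem surCard_congr {G G' : FiniteModule R} (h : Iso G G') (H : FiniteModule R) :
    surCard G H = surCard G' H := by
  obtain ⟨f⟩ := h
  exact Nat.card_congr
    { toFun := fun θ => ⟨θ.1 ∘ₗ f.symm.toLinearMap, θ.2.comp f.symm.surjective⟩
      invFun := fun θ => ⟨θ.1 ∘ₗ f.toLinearMap, θ.2.comp f.surjective⟩
      left_inv := fun θ => by ext; simp
      right_inv := fun θ => by ext; simp }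

theorem momentLimit_surCard [Countable (IsoClass R)] (hX : ∀ n, IsRandomModule (X n))
    {G : FiniteModule R} {L : ℝ} (hL : 0 ≤ L)
    (h : Tendsto (fun n => ∫⁻ ω, (surCard (X n ω) G : ℝ≥0∞) ∂(P n)) atTop
      (𝓝 (ENNReal.ofReal L))) :
    MomentLimit P X (fun H => (surCard H G : ℝ)) L := by
  have hmeas (n : ℕ) : AEStronglyMeasurable (fun ω => (surCard (X n ω) G : ℝ)) (P n) :=
    (measurable_of_isRandomModule (hX n) (g := fun H => (surCard H G : ℝ))
      fun H H' hH => by rw [surCard_congr hH]).aestronglyMeasurable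
  have hnonneg (n : ℕ) : 0 ≤ᵐ[P n] fun ω => (surCard (X n ω) G : ℝ) :=
    .of_forall fun ω => Nat.cast_nonneg _
  have hlintegral (n : ℕ) : ∫⁻ ω, ENNReal.ofReal (surCard (X n ω) G : ℝ) ∂(P n) =
      ∫⁻ ω, (surCard (X n ω) G : ℝ≥0∞) ∂(P n) :=
    lintegral_congr fun ω => ENNReal.ofReal_natCast _
  constructor
  · filter_upwards [h.eventually_lt_const ENNReal.ofReal_lt_top] with n hn
    refine ⟨hmeas n, ?_⟩
    rwa [hasFiniteIntegral_iff_ofReal (hnonneg n), hlintegral]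
  · have htoReal := (ENNReal.tendsto_toReal ENNReal.ofReal_ne_top).comp h
    rw [ENNReal.toReal_ofReal hL] at htoReal
    refine htoReal.congr fun n => ?_
    rw [integral_eq_lintegral_of_nonneg_ae (hnonneg n) (hmeas n), hlintegral]
    rfl

end MomentLimits

section KernelMoments

variable {R : Type*} [Ring R]

instance fintypeSurjective (G H : FiniteModule R) :
    Fintype {φ : G →ₗ[R] H // Function.Surjective φ} :=
  Fintype.ofFinite _

theorem surCard_ofFinite (G : FiniteModule R) (E : Type*) [AddCommGroup E] [Module R E]
    [Finite E] :
    surCard G (ofFinite R E) = Nat.card {θ : G →ₗ[R] E // Function.Surjective θ} := by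
  let f := ofFiniteEquiv (R := R) E
  exact Nat.card_congr
    { toFun := fun θ => ⟨f.toLinearMap ∘ₗ θ.1, f.surjective.comp θ.2⟩
      invFun := fun θ => ⟨f.symm.toLinearMap ∘ₗ θ.1, f.symm.surjective.comp θ.2⟩
      left_inv := fun θ => by ext; simp
      right_inv := fun θ => by ext; simp }

instance finite_hom_free {d : ℕ} {M : Type*} [AddCommGroup M] [Module R M] [Finite M] :
    Finite ((Fin d → R) →ₗ[R] M) :=
  Finite.of_equiv _ ((Pi.basisFun R (Fin d)).constr ℕ).toEquiv

theorem IsCohenLenstraRing.natCard_hom_ker_eq (hR : IsCohenLenstraRing R) {ι : Type*}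
    {K : ι → FiniteModule R} (hK : ∀ i, IsSimpleModule R (K i)) (l : List ι) {F : Type*}
    [AddCommGroup F] [Module R F] [Finite F] {d : ℕ} {p : (Fin d → R) →ₗ[R] F}
    (hp : Function.Surjective p) :
    Nat.card (LinearMap.ker p →ₗ[R] sumOfList K l) =
      Nat.card ((Fin d → R) →ₗ[R] sumOfList K l) := by
  have : Finite ((Fin d → R) ⧸ LinearMap.ker p) :=
    .of_equiv _ (p.quotKerEquivOfSurjective hp).symm.toEquiv
  rw [natCard_hom_sumOfList, natCard_hom_sumOfList,
    List.map_congr_left fun i _ => hR.natCard_hom_eq (K i) (hK i) d (LinearMap.ker p) this]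

variable {Ω : ℕ → Type*} [∀ n, MeasurableSpace (Ω n)] {P : ∀ n, Measure (Ω n)}
  {X : ∀ n, Ω n → FiniteModule R} {W : FiniteModule R → ℝ}

theorem momentLimit_surjective_ker (hR : IsCohenLenstraRing R) (hW : IsWeight W)
    (hmom : ∀ G, MomentLimit P X (fun H => (surCard H G : ℝ)) (1 / W G)) (F : FiniteModule R)
    {ι : Type*} {K : ι → FiniteModule R} (hK : ∀ i, IsSimpleModule R (K i)) (l : List ι) :
    MomentLimit P X (fun G => ∑ φ : {φ : G →ₗ[R] F // Function.Surjective φ},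
      (Nat.card {ψ : LinearMap.ker φ.1 →ₗ[R] sumOfList K l // Function.Surjective ψ} : ℝ))
      (1 / (W F * W (sumOfList K l))) := by
  obtain ⟨p, hp⟩ := exists_surjective_of_finite (R := R) F
  set M := sumOfList K l
  set q := Nat.card ((Fin (Nat.card F) → R) →ₗ[R] M)
  have hcard : Nat.card (LinearMap.ker p →ₗ[R] M) = q := hR.natCard_hom_ker_eq hK l hp
  have hq : q ≠ 0 := Nat.card_pos.ne'
  have : Finite (LinearMap.ker p →ₗ[R] M) := Nat.finite_of_card_ne_zero (hcard ▸ hq)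
  have := Fintype.ofFinite (LinearMap.ker p →ₗ[R] M)
  have := fun η : LinearMap.ker p →ₗ[R] M => Pushout.finite η
  have hpushout : MomentLimit P X
      (fun G => ∑ η : LinearMap.ker p →ₗ[R] M, (surCard G (ofFinite R (Pushout η)) : ℝ))
      (∑ η : LinearMap.ker p →ₗ[R] M, 1 / (W F * W M)) := by
    refine MomentLimit.sum _ fun η _ => ?_
    rw [← hW.pushout hp η]
    exact hmom _
  refine (hpushout.const_mul (q : ℝ)⁻¹).congr (fun G => ?_) ?_
  · rw [inv_mul_eq_iff_eq_mul₀ (Nat.cast_ne_zero.mpr hq), mul_comm]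
    simp_rw [surCard_ofFinite]
    exact_mod_cast sum_natCard_surjective_pushout (X := G) (M := M) hp
  · rw [Finset.sum_const, Finset.card_univ, ← Nat.card_eq_fintype_card, hcard, nsmul_eq_mul,
      inv_mul_cancel_left₀ (Nat.cast_ne_zero.mpr hq)]

theorem exists_list_count {ι : Type*} [Finite ι] [DecidableEq ι] (d : ι → ℕ) :
    ∃ l : List ι, ∀ i, l.count i = d i := by
  refine ⟨(Finsupp.toMultiset (Finsupp.equivFunOnFinite.symm d)).toList, fun i => ?_⟩
  rw [← Multiset.coe_count, Multiset.coe_toList, Finsupp.count_toMultiset]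
  rfl

/-- The cardinality of the endomorphism field of a finite simple module. -/
abbrev SimpleClass.endCard (i : SimpleClass R) : ℝ :=
  Nat.card (Module.End R i.rep)

theorem SimpleClass.two_le_endCard (i : SimpleClass R) : 2 ≤ i.endCard := by
  exact_mod_cast one_lt_natCard_end (R := R) (K := i.rep)

variable [Fintype (SimpleClass R)]

/-- The sum over the surjections `φ : G → F` of a product of local factors, where the factor at the
simple module `K i` depends on the number of homomorphisms `ker φ → K i`. -/
def kernelSum (F : FiniteModule R) (g : SimpleClass R → ℝ → ℝ) (G : FiniteModule R) : ℝ :=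
  ∑ φ : {φ : G →ₗ[R] F // Function.Surjective φ},
    ∏ i, g i (Nat.card (LinearMap.ker φ.1 →ₗ[R] i.rep))

theorem momentLimit_kernelSum_sieveTerm (hR : IsCohenLenstraRing R) (hW : IsWeight W)
    (hmom : ∀ G, MomentLimit P X (fun H => (surCard H G : ℝ)) (1 / W G)) (F : FiniteModule R)
    (d : SimpleClass R → ℕ) :
    MomentLimit P X (kernelSum F fun i Q => sieveTerm i.endCard Q (d i))
      (1 / W F * ∏ i : SimpleClass R, limitTerm i.endCard (1 / W i.rep) (d i)) := by
  classical
  obtain ⟨l, hl⟩ := exists_list_count d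
  refine ((momentLimit_surjective_ker hR hW hmom F SimpleClass.isSimpleModule l).const_mul
    (∏ i : SimpleClass R, ∏ j ∈ Finset.range (d i), (i.endCard ^ (j + 1) - 1))⁻¹).congr
    (fun G => ?_) ?_
  · rw [Finset.mul_sum]
    refine Finset.sum_congr rfl fun φ _ => ?_
    rw [natCard_surjective_sumOfList SimpleClass.isSimpleModule SimpleClass.eq_of_iso,
      inv_mul_eq_div, ← Finset.prod_div_distrib]
    refine Finset.prod_congr rfl fun i _ => ?_
    simp only [hl, sieveTerm, Finset.prod_div_distrib]
  · rw [hW.sumOfList, inv_mul_eq_div, one_div, mul_inv, ← Finset.prod_inv_distrib, mul_div_assoc,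
      ← Finset.prod_div_distrib, one_div]
    refine congrArg _ (Finset.prod_congr rfl fun i _ => ?_)
    rw [hl, limitTerm, Finset.prod_div_distrib, Finset.prod_const, Finset.card_range, one_div,
      inv_pow]

end KernelMoments

section Isomorphisms

variable {R : Type*} [Ring R]

theorem autCard_pos (G : FiniteModule R) : 0 < autCard G := by
  have : Finite (G ≃ₗ[R] G) := .of_injective _ LinearEquiv.toLinearMap_injective
  have : Nonempty (G ≃ₗ[R] G) := ⟨LinearEquiv.refl R G⟩
  exact Nat.card_pos

theorem autCard_congr {G H : FiniteModule R} (h : Iso G H) : autCard G = autCard H := by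
  obtain ⟨f⟩ := h
  exact Nat.card_congr
    { toFun := fun g => (f.symm.trans g).trans f
      invFun := fun g => (f.trans g).trans f.symm
      left_inv := fun g => by ext; simp
      right_inv := fun g => by ext; simp }

/-- The mass of a finite module in the Cohen–Lenstra–Martinet measure of weight `W`, before
normalization to total mass one. -/
def mass (W : FiniteModule R → ℝ) (G : FiniteModule R) : ℝ :=
  1 / (W G * autCard G)

theorem mass_div (W : FiniteModule R → ℝ) (G : FiniteModule R) (z : ℝ) :
    mass W G / z = 1 / (autCard G * W G * z) := by
  rw [mass, div_div, mul_comm (W G)]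

theorem mass_div_mass (W : FiniteModule R → ℝ) (G H : FiniteModule R) :
    mass W G / mass W H = (W H * autCard H) / (W G * autCard G) := by
  rw [mass, mass, div_div_div_eq, one_mul, mul_one]

variable {W : FiniteModule R → ℝ}

theorem IsWeight.mass_pos (hW : IsWeight W) (G : FiniteModule R) : 0 < mass W G :=
  _root_.one_div_pos.mpr (mul_pos (hW.pos G) (Nat.cast_pos.mpr (autCard_pos G)))

theorem IsWeight.mass_congr (hW : IsWeight W) {G H : FiniteModule R} (h : Iso G H) :
    mass W G = mass W H := by
  rw [mass, mass, hW.congr h, autCard_congr h]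

open Classical in
theorem sum_surjective_ker_eq_bot (G F : FiniteModule R) :
    (∑ φ : {φ : G →ₗ[R] F // Function.Surjective φ},
      if LinearMap.ker φ.1 = ⊥ then (1 : ℝ) else 0) =
        if Iso G F then (autCard F : ℝ) else 0 := by
  rw [Finset.sum_boole]
  split_ifs with h
  · obtain ⟨f⟩ := h
    rw [← Fintype.card_subtype, ← Nat.card_eq_fintype_card]
    exact congrArg _ <| Nat.card_congr
      { toFun := fun φ => f.symm.trans (LinearEquiv.ofBijective φ.1.1
          ⟨LinearMap.ker_eq_bot.mp φ.2, φ.1.2⟩)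
        invFun := fun g => ⟨⟨(f.trans g).toLinearMap, (f.trans g).surjective⟩, LinearEquiv.ker _⟩
        left_inv := fun φ => by
          ext x
          exact congrArg φ.1.1 (f.symm_apply_apply x)
        right_inv := fun g => by
          ext x
          exact congrArg g (f.apply_symm_apply x) }
  · rw [Finset.filter_false_of_mem, Finset.card_empty, Nat.cast_zero]
    exact fun φ _ hφ => h ⟨LinearEquiv.ofBijective φ.1 ⟨LinearMap.ker_eq_bot.mp hφ, φ.2⟩⟩

theorem subsingleton_iff_natCard_hom_eq_one (M : Type*) [AddCommGroup M] [Module R M] [Finite M] :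
    Subsingleton M ↔ ∀ i : SimpleClass R, Nat.card (M →ₗ[R] i.rep) = 1 := by
  refine ⟨fun _ i => ?_, fun h => ?_⟩
  · have : Unique (M →ₗ[R] i.rep) :=
      ⟨⟨0⟩, fun f => LinearMap.ext fun x => by rw [Subsingleton.elim x 0, map_zero, map_zero]⟩
    exact Nat.card_unique
  · by_contra hM
    rw [not_subsingleton_iff_nontrivial] at hM
    obtain ⟨i, f, hf⟩ := exists_surjective_simpleClass (R := R) M
    have := IsSimpleModule.nontrivial R i.rep
    obtain ⟨k, hk⟩ := exists_ne (0 : i.rep)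
    obtain ⟨x, rfl⟩ := hf k
    have := (Nat.card_eq_one_iff_unique.mp (h i)).1
    exact hk (LinearMap.congr_fun (Subsingleton.elim f 0) x)

variable [Fintype (SimpleClass R)]

open Classical in
theorem abs_indicator_subsingleton_sub_prod_sieveSum_le (M : Type*) [AddCommGroup M] [Module R M]
    [Finite M] (D : ℕ) :
    |(if Subsingleton M then (1 : ℝ) else 0) -
      ∏ i : SimpleClass R, sieveSum i.endCard (Nat.card (M →ₗ[R] i.rep)) D| ≤
        ∏ i : SimpleClass R, (1 + sieveTerm i.endCard (Nat.card (M →ₗ[R] i.rep)) (D + 1)) - 1 := by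
  choose r hr using fun i : SimpleClass R =>
    exists_natCard_hom_eq_pow (R := R) (X := M) (K := i.rep)
  have hr_zero (i : SimpleClass R) : Nat.card (M →ₗ[R] i.rep) = 1 ↔ r i = 0 := by
    rw [hr, Nat.pow_eq_one, or_iff_right (one_lt_natCard_end (R := R) (K := i.rep)).ne']
  have hprod : (if Subsingleton M then (1 : ℝ) else 0) =
      ∏ i : SimpleClass R, if r i = 0 then (1 : ℝ) else 0 := by
    simp only [Finset.prod_ite_zero, Finset.prod_const_one, Finset.mem_univ, forall_const,
      subsingleton_iff_natCard_hom_eq_one (R := R) M, hr_zero]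
  rw [hprod]
  refine abs_prod_sub_prod_le Finset.univ (fun i _ => ?_) fun i _ => ?_
  · split_ifs <;> simp
  · rw [hr, Nat.cast_pow]
    exact abs_indicator_sub_sieveSum_le (one_lt_two.trans_le i.two_le_endCard) (r i) D

open Classical in
theorem abs_indicator_iso_sub_kernelSum_le (G F : FiniteModule R) (D : ℕ) :
    |(if Iso G F then (autCard F : ℝ) else 0) -
      kernelSum F (fun i Q => sieveSum i.endCard Q D) G| ≤
        kernelSum F (fun i Q => 1 + sieveTerm i.endCard Q (D + 1)) G - surCard G F := by
  have hsurCard : (surCard G F : ℝ) =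
      ∑ _φ : {φ : G →ₗ[R] F // Function.Surjective φ}, (1 : ℝ) := by
    rw [surCard, Nat.card_eq_fintype_card, Finset.sum_const, Finset.card_univ, nsmul_one]
  rw [← sum_surjective_ker_eq_bot, hsurCard, kernelSum, kernelSum, ← Finset.sum_sub_distrib,
    ← Finset.sum_sub_distrib]
  refine (Finset.abs_sum_le_sum_abs _ _).trans (Finset.sum_le_sum fun φ _ => ?_)
  simp only [← Submodule.subsingleton_iff_eq_bot]
  exact abs_indicator_subsingleton_sub_prod_sieveSum_le (LinearMap.ker φ.1) D

end Isomorphisms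

section SievedMoments

theorem tendsto_of_abs_sub_le {a : ℕ → ℝ} {b e : ℕ → ℕ → ℝ} {β η : ℕ → ℝ} {L : ℝ}
    (h : ∀ D, ∀ᶠ n in atTop, |a n - b D n| ≤ e D n)
    (hb : ∀ D, Tendsto (b D) atTop (𝓝 (β D))) (he : ∀ D, Tendsto (e D) atTop (𝓝 (η D)))
    (hβ : Tendsto β atTop (𝓝 L)) (hη : Tendsto η atTop (𝓝 0)) : Tendsto a atTop (𝓝 L) := by
  rw [Metric.tendsto_atTop']
  intro ε hε
  have hη_add : Tendsto (fun D => η D + |β D - L|) atTop (𝓝 0) := by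
    simpa only [sub_self, abs_zero, add_zero] using hη.add (hβ.sub_const L).abs
  obtain ⟨D, hD⟩ := (hη_add.eventually_lt_const hε).exists
  have he_add : Tendsto (fun n => e D n + |b D n - L|) atTop (𝓝 (η D + |β D - L|)) :=
    (he D).add ((hb D).sub_const L).abs
  obtain ⟨N, hN⟩ := ((h D).and (he_add.eventually_lt_const hD)).exists_forall_of_atTop
  refine ⟨N, fun n hn => ?_⟩
  obtain ⟨hle, hlt⟩ := hN n hn.le
  rw [Real.dist_eq]
  linarith [abs_sub_le (a n) (b D n) L]

variable {R : Type*} [Ring R] {Ω : ℕ → Type*} [∀ n, MeasurableSpace (Ω n)]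
  {P : ∀ n, Measure (Ω n)} {X : ∀ n, Ω n → FiniteModule R}

theorem MomentLimit.of_abs_sub_le {g : FiniteModule R → ℝ} {b e : ℕ → FiniteModule R → ℝ}
    {β η : ℕ → ℝ} {L : ℝ} (hg : ∀ n, Integrable (fun ω => g (X n ω)) (P n))
    (h : ∀ D G, |g G - b D G| ≤ e D G) (hb : ∀ D, MomentLimit P X (b D) (β D))
    (he : ∀ D, MomentLimit P X (e D) (η D)) (hβ : Tendsto β atTop (𝓝 L))
    (hη : Tendsto η atTop (𝓝 0)) : MomentLimit P X g L := by
  refine ⟨.of_forall hg, tendsto_of_abs_sub_le (fun D => ?_) (fun D => (hb D).2)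
    (fun D => (he D).2) hβ hη⟩
  filter_upwards [(hb D).1, (he D).1] with n hbn hen
  rw [← integral_sub (hg n) hbn]
  exact abs_integral_le_integral_abs.trans
    (integral_mono ((hg n).sub hbn).abs hen fun ω => h D (X n ω))

variable {W : FiniteModule R → ℝ}

section KernelSum

variable [Fintype (SimpleClass R)]

theorem momentLimit_kernelSum_sum_sieveTerm (hR : IsCohenLenstraRing R) (hW : IsWeight W)
    (hmom : ∀ G, MomentLimit P X (fun H => (surCard H G : ℝ)) (1 / W G)) (F : FiniteModule R)
    (t : Finset ℕ) (c : ℕ → ℝ) :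
    MomentLimit P X (kernelSum F fun i Q => ∑ d ∈ t, c d * sieveTerm i.endCard Q d)
      (1 / W F * ∏ i : SimpleClass R, ∑ d ∈ t, c d * limitTerm i.endCard (1 / W i.rep) d) := by
  classical
  refine (MomentLimit.sum (Fintype.piFinset fun _ : SimpleClass R => t) fun d _ =>
    (momentLimit_kernelSum_sieveTerm hR hW hmom F d).const_mul (∏ i, c (d i))).congr
      (fun G => ?_) ?_
  · simp_rw [kernelSum, Finset.mul_sum]
    rw [Finset.sum_comm]
    refine Finset.sum_congr rfl fun φ _ => ?_
    rw [Finset.prod_univ_sum]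
    exact Finset.sum_congr rfl fun d _ => Finset.prod_mul_distrib.symm
  · rw [Finset.prod_univ_sum, Finset.mul_sum]
    refine Finset.sum_congr rfl fun d _ => ?_
    rw [mul_left_comm, Finset.prod_mul_distrib]

theorem momentLimit_kernelSum_one_add_sieveTerm (hR : IsCohenLenstraRing R) (hW : IsWeight W)
    (hmom : ∀ G, MomentLimit P X (fun H => (surCard H G : ℝ)) (1 / W G)) (F : FiniteModule R)
    (D : ℕ) :
    MomentLimit P X (kernelSum F fun i Q => 1 + sieveTerm i.endCard Q (D + 1))
      (1 / W F * ∏ i : SimpleClass R, (1 + limitTerm i.endCard (1 / W i.rep) (D + 1))) := by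
  simpa only [Finset.sum_pair (Nat.succ_ne_zero D).symm, one_mul, sieveTerm_zero, limitTerm_zero]
    using momentLimit_kernelSum_sum_sieveTerm hR hW hmom F {0, D + 1} fun _ => 1

theorem IsWeight.tendsto_prod_one_add_limitTerm (hW : IsWeight W) :
    Tendsto (fun D : ℕ => ∏ i : SimpleClass R, (1 + limitTerm i.endCard (1 / W i.rep) (D + 1)))
      atTop (𝓝 1) := by
  have htendsto (i : SimpleClass R) :
      Tendsto (fun D => 1 + limitTerm i.endCard (1 / W i.rep) (D + 1)) atTop (𝓝 1) := by
    simpa only [add_zero] using ((tendsto_add_atTop_iff_nat 1).mpr (tendsto_limitTerm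
      i.two_le_endCard (hW.one_div_pos i.rep) (hW.one_div_le_one i.rep))).const_add 1
  simpa only [Finset.prod_const_one] using tendsto_finsetProd Finset.univ fun i _ => htendsto i

end KernelSum

variable [∀ n, IsProbabilityMeasure (P n)]

open Classical in
theorem exists_momentLimit_iso (hR : IsCohenLenstraRing R) (hW : IsWeight W)
    (hX : ∀ n, IsRandomModule (X n))
    (hmom : ∀ G, MomentLimit P X (fun H => (surCard H G : ℝ)) (1 / W G)) :
    ∃ c : ℝ, 0 < c ∧ ∀ F,
      MomentLimit P X (fun G => if Iso G F then (autCard F : ℝ) else 0) (1 / W F * c) := by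
  have := hR.finite_simpleClass
  have := Fintype.ofFinite (SimpleClass R)
  choose c hc_pos hc using fun i : SimpleClass R => exists_pos_tendsto_sum_limitTerm
    i.two_le_endCard (hW.one_div_pos i.rep) (hW.one_div_le_one i.rep)
  refine ⟨∏ i, c i, Finset.prod_pos fun i _ => hc_pos i, fun F => ?_⟩
  refine MomentLimit.of_abs_sub_le
    (fun n => (integrable_const (autCard F : ℝ)).indicator (hX n F))
    (fun D G => abs_indicator_iso_sub_kernelSum_le G F D)
    (fun D => momentLimit_kernelSum_sum_sieveTerm hR hW hmom F (Finset.range (D + 1)) fun d =>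
      (-1) ^ d)
    (fun D => (momentLimit_kernelSum_one_add_sieveTerm hR hW hmom F D).sub (hmom F))
    ((tendsto_finsetProd _ fun i _ => hc i).const_mul _) ?_
  simpa only [mul_one, sub_self] using
    (hW.tendsto_prod_one_add_limitTerm.const_mul (1 / W F)).sub_const (1 / W F)

theorem exists_tendsto_iso (hR : IsCohenLenstraRing R) (hW : IsWeight W)
    (hX : ∀ n, IsRandomModule (X n))
    (hmom : ∀ G, MomentLimit P X (fun H => (surCard H G : ℝ)) (1 / W G)) :
    ∃ c : ℝ, 0 < c ∧ ∀ F, Tendsto (fun n => (P n).real {ω | Iso (X n ω) F}) atTop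
      (𝓝 (c * mass W F)) := by
  classical
  obtain ⟨c, hc_pos, hc⟩ := exists_momentLimit_iso hR hW hX hmom
  refine ⟨c, hc_pos, fun F => ?_⟩
  have hautCard : (autCard F : ℝ) ≠ 0 := Nat.cast_ne_zero.mpr (autCard_pos F).ne'
  have hintegral (n : ℕ) : ∫ ω, (if Iso (X n ω) F then (autCard F : ℝ) else 0) ∂P n =
      (P n).real {ω | Iso (X n ω) F} * autCard F :=
    integral_indicator_const (autCard F : ℝ) (hX n F)
  convert (hc F).2.mul_const (autCard F : ℝ)⁻¹ using 2 with n
  · rw [hintegral, mul_inv_cancel_right₀ hautCard]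
  · rw [mass, one_div, one_div, mul_inv, mul_right_comm, mul_comm]

end SievedMoments

section SurjectionCounts

variable {R : Type*} [Ring R]

theorem natCard_hom_le_surCard_add_one (G K : FiniteModule R) [IsSimpleModule R K] :
    Nat.card (G →ₗ[R] K) ≤ surCard G K + 1 := by
  have heq_zero (f : {f : G →ₗ[R] K // ¬ Function.Surjective f}) : f.1 = 0 :=
    f.1.surjective_or_eq_zero.resolve_left f.2
  have : Subsingleton {f : G →ₗ[R] K // ¬ Function.Surjective f} :=
    ⟨fun f g => Subtype.ext ((heq_zero f).trans (heq_zero g).symm)⟩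
  classical
  rw [← Nat.card_congr (Equiv.sumCompl fun f : G →ₗ[R] K => Function.Surjective f), Nat.card_sum]
  exact Nat.add_le_add_left (Finite.card_le_one_iff_subsingleton.mpr this) _

theorem autCard_le_surCard {G F : FiniteModule R} {f : G →ₗ[R] F} (hf : Function.Surjective f) :
    autCard F ≤ surCard G F := by
  refine Nat.card_le_card_of_injective
    (fun g : F ≃ₗ[R] F => (⟨g.toLinearMap ∘ₗ f, g.surjective.comp hf⟩ :
      {f : G →ₗ[R] F // Function.Surjective f})) fun g g' h => ?_
  ext x
  obtain ⟨y, rfl⟩ := hf x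
  exact LinearMap.congr_fun (Subtype.ext_iff.mp h) y

theorem zsmul_eq_zero_of_forall_exists_mul_zsmul_eq {N : ℤ}
    (hN : ∀ Y : FiniteModule R, (∀ y : Y, ∃ y' : Y, N • y' = y) → Subsingleton Y)
    {G : FiniteModule R} {a : ℤ} (h : ∀ x : G, ∃ x' : G, (a * N) • x' = a • x) (x : G) :
    a • x = 0 := by
  let M : Submodule R G := LinearMap.range (a • (LinearMap.id : G →ₗ[R] G))
  have hM : Subsingleton M := by
    refine hN ⟨M⟩ ?_
    rintro ⟨_, x, rfl⟩
    obtain ⟨x', hx'⟩ := h x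
    exact ⟨⟨a • x', x', rfl⟩, Subtype.ext ((smul_smul N a x').trans (mul_comm N a ▸ hx'))⟩
  exact Subtype.ext_iff.mp (Subsingleton.elim (⟨a • x, x, rfl⟩ : M) 0)

theorem exists_surjective_of_not_zsmul_eq_zero {N : ℤ}
    (hN : ∀ Y : FiniteModule R, (∀ y : Y, ∃ y' : Y, N • y' = y) → Subsingleton Y)
    {G : FiniteModule R} {a : ℤ} (hG : ¬ ∀ x : G, a • x = 0) :
    ∃ (F : FiniteModule R) (f : G →ₗ[R] F), Function.Surjective f ∧
      (∀ y : F, (a * N) • y = 0) ∧ ¬ ∀ y : F, a • y = 0 := by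
  let U : Submodule R G := LinearMap.range ((a * N) • (LinearMap.id : G →ₗ[R] G))
  have : Finite (G ⧸ U) := .of_surjective _ U.mkQ_surjective
  refine ⟨⟨G ⧸ U⟩, U.mkQ, U.mkQ_surjective, fun y => ?_, fun h => hG ?_⟩
  · obtain ⟨x, rfl⟩ := U.mkQ_surjective y
    exact (Submodule.Quotient.mk_eq_zero U).mpr ⟨x, rfl⟩
  · exact zsmul_eq_zero_of_forall_exists_mul_zsmul_eq hN fun x =>
      (Submodule.Quotient.mk_eq_zero U).mp (h (U.mkQ x))

open Classical in
theorem one_le_sum_indicator_iso {s : Finset (IsoClass R)} {G : FiniteModule R}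
    (hG : isoClass G ∈ s) : 1 ≤ ∑ c ∈ s, if Iso G c.rep then (1 : ℝ) else 0 := by
  refine le_of_eq_of_le ?_ (Finset.single_le_sum (fun c _ => ?_) hG)
  · rw [if_pos (iso_rep_isoClass G).symm]
  · split_ifs <;> norm_num

theorem one_le_sum_inv_autCard_mul_surCard {s : Finset (IsoClass R)} {G F : FiniteModule R}
    (hF : isoClass F ∈ s) {f : G →ₗ[R] F} (hf : Function.Surjective f) :
    1 ≤ ∑ c ∈ s, (autCard c.rep : ℝ)⁻¹ * surCard G c.rep := by
  obtain ⟨g⟩ := iso_rep_isoClass F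
  refine le_trans ?_ (Finset.single_le_sum (fun c _ => by positivity) hF)
  rw [inv_mul_eq_div, one_le_div (Nat.cast_pos.mpr (autCard_pos _)), Nat.cast_le]
  exact autCard_le_surCard (f := g.symm.toLinearMap ∘ₗ f) (g.symm.surjective.comp hf)

theorem exists_ne_zero_zsmul_eq_zero (s : Finset (IsoClass R)) :
    ∃ a : ℤ, a ≠ 0 ∧ ∀ G : FiniteModule R, isoClass G ∈ s → ∀ x : G, a • x = 0 := by
  classical
  refine ⟨∏ c ∈ s, (Nat.card c.rep : ℤ), Finset.prod_ne_zero_iff.mpr fun c _ =>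
    Nat.cast_ne_zero.mpr (Nat.card_pos (α := c.rep)).ne', fun G hG x => ?_⟩
  obtain ⟨f⟩ := iso_rep_isoClass G
  rw [← Finset.prod_erase_mul _ _ hG, mul_smul, natCast_zsmul, Nat.card_congr f.toEquiv,
    card_nsmul_eq_zero', smul_zero]

variable [Fintype (SimpleClass R)]

theorem homCount_congr {G H : FiniteModule R} (h : Iso G H) : homCount R G = homCount R H :=
  (homCount_le_of_surjective h.some.symm.surjective).antisymm
    (homCount_le_of_surjective h.some.surjective)

theorem homCount_le_sum_surCard (G : FiniteModule R) :
    homCount R G ≤ ∑ i : SimpleClass R, (surCard G i.rep + 1) :=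
  Finset.sum_le_sum fun i _ => natCard_hom_le_surCard_add_one G i.rep

theorem one_le_inv_mul_sum_surCard {T : ℕ} {G : FiniteModule R} (h : T < homCount R G) :
    1 ≤ (T + 1 : ℝ)⁻¹ * ∑ i : SimpleClass R, ((surCard G i.rep : ℝ) + 1) := by
  rw [inv_mul_eq_div, one_le_div (by positivity)]
  exact_mod_cast (Nat.succ_le_of_lt h).trans (homCount_le_sum_surCard G)

theorem IsCohenLenstraRing.exists_finset_isoClass_mem (hR : IsCohenLenstraRing R) {n : ℤ}
    (hn : n ≠ 0) (T : ℕ) : ∃ s : Finset (IsoClass R), ∀ G : FiniteModule R, homCount R G ≤ T →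
      (∀ x : G, n • x = 0) → isoClass G ∈ s := by
  refine ⟨(hR.finite_homCount_le hn T).toFinset, fun G hGT hG => ?_⟩
  obtain ⟨f⟩ := iso_rep_isoClass G
  refine (Set.Finite.mem_toFinset _).mpr
    ⟨(homCount_congr ⟨f⟩).trans_le hGT, fun x => f.injective ?_⟩
  rw [map_zsmul, hG, map_zero]

open Classical in
theorem one_le_sum_indicator_iso_add {a N : ℤ}
    (hN : ∀ Y : FiniteModule R, (∀ y : Y, ∃ y' : Y, N • y' = y) → Subsingleton Y) {T : ℕ}
    {s t : Finset (IsoClass R)}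
    (hs : ∀ F : FiniteModule R, homCount R F ≤ T → (∀ x : F, a • x = 0) → isoClass F ∈ s)
    (ht : ∀ F : FiniteModule R, homCount R F ≤ T → (∀ x : F, (a * N) • x = 0) →
      (¬ ∀ x : F, a • x = 0) → isoClass F ∈ t) (G : FiniteModule R) :
    1 ≤ (∑ c ∈ s, (if Iso G c.rep then (1 : ℝ) else 0) +
      (T + 1 : ℝ)⁻¹ * ∑ i : SimpleClass R, ((surCard G i.rep : ℝ) + 1)) +
      ∑ c ∈ t, (autCard c.rep : ℝ)⁻¹ * surCard G c.rep := by
  have hs_nonneg : 0 ≤ ∑ c ∈ s, (if Iso G c.rep then (1 : ℝ) else 0) :=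
    Finset.sum_nonneg fun c _ => by split_ifs <;> norm_num
  have hT_nonneg : 0 ≤ (T + 1 : ℝ)⁻¹ * ∑ i : SimpleClass R, ((surCard G i.rep : ℝ) + 1) := by
    positivity
  have ht_nonneg : 0 ≤ ∑ c ∈ t, (autCard c.rep : ℝ)⁻¹ * surCard G c.rep := by positivity
  obtain hGT | hGT := lt_or_ge T (homCount R G)
  · linarith [one_le_inv_mul_sum_surCard hGT]
  by_cases hG : ∀ x : G, a • x = 0
  · linarith [one_le_sum_indicator_iso (hs G hGT hG)]
  · obtain ⟨F, f, hf, hF, hFa⟩ := exists_surjective_of_not_zsmul_eq_zero hN hG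
    linarith [one_le_sum_inv_autCard_mul_surCard
      (ht F ((homCount_le_of_surjective hf).trans hGT) hF hFa) hf]

end SurjectionCounts

section Tightness

variable {R : Type*} [Ring R] {Ω : ℕ → Type*} [∀ n, MeasurableSpace (Ω n)]
  {P : ∀ n, Measure (Ω n)} {X : ∀ n, Ω n → FiniteModule R} {W : FiniteModule R → ℝ}
  [∀ n, IsProbabilityMeasure (P n)]

theorem MomentLimit.one_le {g : FiniteModule R → ℝ} {L : ℝ} (h : MomentLimit P X g L)
    (hg : ∀ G, 1 ≤ g G) : 1 ≤ L := by
  refine ge_of_tendsto h.2 ?_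
  filter_upwards [h.1] with n hn
  calc (1 : ℝ) = ∫ _, (1 : ℝ) ∂P n := by simp
    _ ≤ ∫ ω, g (X n ω) ∂P n := integral_mono (integrable_const _) hn fun ω => hg _

theorem momentLimit_const (c : ℝ) : MomentLimit P X (fun _ => c) c :=
  ⟨.of_forall fun _ => integrable_const _, by simp⟩

open Classical in
theorem momentLimit_indicator_iso (hX : ∀ n, IsRandomModule (X n)) {F : FiniteModule R} {L : ℝ}
    (h : Tendsto (fun n => (P n).real {ω | Iso (X n ω) F}) atTop (𝓝 L)) :
    MomentLimit P X (fun G => if Iso G F then 1 else 0) L :=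
  ⟨.of_forall fun n => (integrable_const (1 : ℝ)).indicator (hX n F),
    h.congr fun n => (integral_indicator_one (hX n F)).symm⟩

theorem sum_le_one_of_tendsto (hX : ∀ n, IsRandomModule (X n)) {L : IsoClass R → ℝ}
    (hL : ∀ c, Tendsto (fun n => (P n).real {ω | Iso (X n ω) c.rep}) atTop (𝓝 (L c)))
    (s : Finset (IsoClass R)) : ∑ c ∈ s, L c ≤ 1 := by
  refine le_of_tendsto' (tendsto_finsetSum _ fun c _ => hL c) fun n => ?_
  rw [← measureReal_biUnion_finset _ fun c _ => hX n c.rep]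
  · exact measureReal_le_one
  · intro c _ c' _ hcc'
    refine Set.disjoint_left.mpr fun ω h h' => hcc' ?_
    rw [← isoClass_rep c, ← isoClass_rep c']
    exact isoClass_eq_iff.mpr (Iso.trans (Iso.symm h) h')

theorem one_le_sum_limit_add [Fintype (SimpleClass R)] (hX : ∀ n, IsRandomModule (X n))
    (hmom : ∀ G, MomentLimit P X (fun H => (surCard H G : ℝ)) (1 / W G)) {L : IsoClass R → ℝ}
    (hL : ∀ c, Tendsto (fun n => (P n).real {ω | Iso (X n ω) c.rep}) atTop (𝓝 (L c))) {a N : ℤ}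
    (hN : ∀ Y : FiniteModule R, (∀ y : Y, ∃ y' : Y, N • y' = y) → Subsingleton Y) {T : ℕ}
    {s t : Finset (IsoClass R)}
    (hs : ∀ F : FiniteModule R, homCount R F ≤ T → (∀ x : F, a • x = 0) → isoClass F ∈ s)
    (ht : ∀ F : FiniteModule R, homCount R F ≤ T → (∀ x : F, (a * N) • x = 0) →
      (¬ ∀ x : F, a • x = 0) → isoClass F ∈ t) :
    1 ≤ (∑ c ∈ s, L c + (T + 1 : ℝ)⁻¹ * ∑ i : SimpleClass R, (1 / W i.rep + 1)) +
      ∑ c ∈ t, mass W c.rep := by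
  classical
  have hmass (c : IsoClass R) : mass W c.rep = (autCard c.rep : ℝ)⁻¹ * (1 / W c.rep) := by
    rw [mass, one_div, one_div, mul_inv_rev]
  simp only [hmass]
  exact (((MomentLimit.sum s fun c _ => momentLimit_indicator_iso hX (hL c)).add
    ((MomentLimit.sum _ fun i _ => (hmom _).add (momentLimit_const 1)).const_mul _)).add
    (MomentLimit.sum t fun c _ => (hmom _).const_mul _)).one_le
      (one_le_sum_indicator_iso_add hN hs ht)

theorem exists_one_le_sum_limit_add (hR : IsCohenLenstraRing R) (hX : ∀ n, IsRandomModule (X n))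
    (hmom : ∀ G, MomentLimit P X (fun H => (surCard H G : ℝ)) (1 / W G)) {L : IsoClass R → ℝ}
    (hL : ∀ c, Tendsto (fun n => (P n).real {ω | Iso (X n ω) c.rep}) atTop (𝓝 (L c)))
    (hmass : Summable fun c : IsoClass R => mass W c.rep) {ε : ℝ} (hε : 0 < ε) :
    ∃ s : Finset (IsoClass R), 1 ≤ ∑ c ∈ s, L c + ε := by
  classical
  have := hR.finite_simpleClass
  have := Fintype.ofFinite (SimpleClass R)
  obtain ⟨N, hN_ne, -, hN⟩ := hR.exists_radical
  obtain ⟨T, hT⟩ : ∃ T : ℕ, (T + 1 : ℝ)⁻¹ * ∑ i : SimpleClass R, (1 / W i.rep + 1) < ε / 2 := by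
    have htendsto := (tendsto_one_div_add_atTop_nhds_zero_nat (𝕜 := ℝ)).mul_const
      (∑ i : SimpleClass R, (1 / W i.rep + 1))
    rw [zero_mul] at htendsto
    simpa only [one_div] using (htendsto.eventually_lt_const (half_pos hε)).exists
  obtain ⟨s₀, hs₀⟩ := summable_iff_vanishing.mp hmass _ (Iio_mem_nhds (half_pos hε))
  obtain ⟨a, ha_ne, ha⟩ := exists_ne_zero_zsmul_eq_zero s₀
  obtain ⟨s, hs⟩ := hR.exists_finset_isoClass_mem ha_ne T
  obtain ⟨t, ht⟩ := hR.exists_finset_isoClass_mem (mul_ne_zero ha_ne hN_ne) T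
  have hle := one_le_sum_limit_add hX hmom hL hN hs (t := t \ s₀) fun F hFT hF hFa =>
    Finset.mem_sdiff.mpr ⟨ht F hFT hF, fun hFs => hFa (ha F hFs)⟩
  have hlt : ∑ c ∈ t \ s₀, mass W c.rep < ε / 2 := hs₀ _ Finset.sdiff_disjoint
  exact ⟨s, by linarith⟩

theorem hasSum_one_of_tendsto (hR : IsCohenLenstraRing R) (hW : IsWeight W)
    (hX : ∀ n, IsRandomModule (X n))
    (hmom : ∀ G, MomentLimit P X (fun H => (surCard H G : ℝ)) (1 / W G)) {c : ℝ} (hc : 0 < c)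
    (hlim : ∀ F, Tendsto (fun n => (P n).real {ω | Iso (X n ω) F}) atTop (𝓝 (c * mass W F))) :
    HasSum (fun C : IsoClass R => c * mass W C.rep) 1 := by
  have hnonneg (C : IsoClass R) : 0 ≤ c * mass W C.rep := (mul_pos hc (hW.mass_pos _)).le
  have hle_one := sum_le_one_of_tendsto hX fun C => hlim C.rep
  have hsummable : Summable fun C : IsoClass R => c * mass W C.rep :=
    summable_of_sum_le hnonneg hle_one
  refine hsummable.hasSum_iff.mpr ((hsummable.tsum_le_of_sum_le hle_one).antisymm ?_)
  refine le_of_forall_pos_le_add fun ε hε => ?_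
  obtain ⟨s, hs⟩ := exists_one_le_sum_limit_add hR hX hmom (fun C => hlim C.rep)
    ((summable_mul_left_iff hc.ne').mp hsummable) hε
  exact hs.trans (add_le_add_left (hsummable.sum_le_tsum s fun C _ => hnonneg C) ε)

theorem tendsto_iso_of_moments (hR : IsCohenLenstraRing R) (hW : IsWeight W)
    (hX : ∀ n, IsRandomModule (X n))
    (hmom : ∀ G, MomentLimit P X (fun H => (surCard H G : ℝ)) (1 / W G)) :
    (Summable fun C : IsoClass R => mass W C.rep) ∧
      ∀ G, Tendsto (fun n => (P n).real {ω | Iso (X n ω) G}) atTop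
        (𝓝 (mass W G / ∑' C : IsoClass R, mass W C.rep)) := by
  obtain ⟨c, hc, hlim⟩ := exists_tendsto_iso hR hW hX hmom
  have hsum := hasSum_one_of_tendsto hR hW hX hmom hc hlim
  refine ⟨(summable_mul_left_iff hc.ne').mp hsum.summable, fun G => ?_⟩
  have htsum := hsum.tsum_eq
  rw [tsum_mul_left] at htsum
  rw [div_eq_inv_mul, ← eq_inv_of_mul_eq_one_left htsum]
  exact hlim G

end Tightness

section Distribution

variable {R : Type*} [Ring R] {W : FiniteModule R → ℝ}

theorem IsWeight.tsum_mass_pos (hW : IsWeight W)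
    (hmass : Summable fun C : IsoClass R => mass W C.rep) :
    0 < ∑' C : IsoClass R, mass W C.rep :=
  hmass.tsum_pos (fun _ => (hW.mass_pos _).le) (isoClass ⟨PUnit⟩) (hW.mass_pos _)

theorem tsum_toReal_pmf {α : Type*} (p : PMF α) : ∑' a, (p a).toReal = 1 := by
  rw [← ENNReal.tsum_toReal_eq p.apply_ne_top, p.tsum_coe, ENNReal.toReal_one]

theorem pmf_ratio_iff (hW : IsWeight W) (hmass : Summable fun C : IsoClass R => mass W C.rep)
    (p : PMF (IsoClass R)) :
    (∀ G₁ G₂ : FiniteModule R, (p (isoClass G₁)).toReal / (p (isoClass G₂)).toReal =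
      mass W G₁ / mass W G₂) ↔
    ∀ G, (p (isoClass G)).toReal = mass W G / ∑' C : IsoClass R, mass W C.rep := by
  have htsum := hW.tsum_mass_pos hmass
  constructor
  · intro h G
    have hne : (p (isoClass G)).toReal ≠ 0 := fun hzero => by
      have hself := h G G
      rw [hzero, zero_div, div_self (hW.mass_pos G).ne'] at hself
      exact zero_ne_one hself
    have happly (C : IsoClass R) :
        (p C).toReal = (p (isoClass G)).toReal / mass W G * mass W C.rep := by
      have hC := h C.rep G
      rw [isoClass_rep, div_eq_iff hne] at hC
      rw [hC]
      ring
    have hone := tsum_toReal_pmf p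
    rw [tsum_congr happly, tsum_mul_left, div_mul_eq_mul_div,
      div_eq_one_iff_eq (hW.mass_pos G).ne'] at hone
    exact (eq_div_iff htsum.ne').mpr hone
  · intro h G₁ G₂
    rw [h, h, div_div_div_cancel_right₀ htsum.ne']

theorem existsUnique_pmf_ratio (hW : IsWeight W)
    (hmass : Summable fun C : IsoClass R => mass W C.rep) :
    ∃! p : PMF (IsoClass R), ∀ G₁ G₂ : FiniteModule R,
      (p (isoClass G₁)).toReal / (p (isoClass G₂)).toReal = mass W G₁ / mass W G₂ := by
  simp_rw [pmf_ratio_iff hW hmass]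
  set z := ∑' C : IsoClass R, mass W C.rep with hz
  have hz_pos : 0 < z := hW.tsum_mass_pos hmass
  have hnonneg (C : IsoClass R) : 0 ≤ mass W C.rep / z := (div_pos (hW.mass_pos _) hz_pos).le
  have hone : ∑' C : IsoClass R, ENNReal.ofReal (mass W C.rep / z) = 1 := by
    rw [← ENNReal.ofReal_tsum_of_nonneg hnonneg (hmass.div_const z), tsum_div_const, ← hz,
      div_self hz_pos.ne', ENNReal.ofReal_one]
  refine ⟨⟨fun C => ENNReal.ofReal (mass W C.rep / z), hone ▸ ENNReal.summable.hasSum⟩,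
    fun G => ?_, fun p hp => PMF.ext fun C => ?_⟩
  · refine (ENNReal.toReal_ofReal (hnonneg _)).trans ?_
    rw [hW.mass_congr (iso_rep_isoClass G)]
  · refine (ENNReal.toReal_eq_toReal_iff' (p.apply_ne_top C) ENNReal.ofReal_ne_top).mp ?_
    rw [ENNReal.toReal_ofReal (hnonneg C), ← isoClass_rep C, hp, isoClass_rep]

end Distribution

section PrimesOfRing

variable {B : Type*} [Ring B] {s : Finset Nat.Primes}

theorem mem_of_nsmul_eq_zero (hB : ∀ p : Nat.Primes, p ∉ s → IsUnit ((p : ℕ) : B))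
    {Y : Type*} [AddCommGroup Y] [Module B Y] {p : Nat.Primes} {y : Y} (hy : y ≠ 0)
    (h : (p : ℕ) • y = 0) : p ∈ s := by
  by_contra hp
  refine hy ((hB p hp).smul_left_cancel.mp ?_)
  rw [Nat.cast_smul_eq_nsmul, h, smul_zero]

theorem exists_mem_nsmul_eq_zero (hB : ∀ p : Nat.Primes, p ∉ s → IsUnit ((p : ℕ) : B))
    (Y : Type*) [AddCommGroup Y] [Module B Y] [Finite Y] [Nontrivial Y] :
    ∃ p ∈ s, ∃ y : Y, y ≠ 0 ∧ (p : ℕ) • y = 0 := by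
  obtain ⟨p, hp, hpY⟩ := Nat.exists_prime_and_dvd (Finite.one_lt_card (α := Y)).ne'
  have := Fact.mk hp
  obtain ⟨y, hy⟩ := exists_prime_addOrderOf_dvd_card' p hpY
  have hy_ne : y ≠ 0 := fun h => hp.ne_one (by rw [← hy, h, addOrderOf_zero])
  have hpy : p • y = 0 := by rw [← hy, addOrderOf_nsmul_eq_zero]
  exact ⟨⟨p, hp⟩, mem_of_nsmul_eq_zero hB (p := ⟨p, hp⟩) hy_ne hpy, y, hy_ne, hpy⟩

theorem prod_zsmul_eq_zero {Y : Type*} [AddCommGroup Y] {p : Nat.Primes} (hp : p ∈ s) {y : Y}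
    (h : (p : ℕ) • y = 0) : (∏ q ∈ s, ((q : ℕ) : ℤ)) • y = 0 := by
  rw [← Finset.prod_erase_mul _ _ hp, mul_smul, natCast_zsmul, h, smul_zero]

theorem prod_zsmul_eq_zero_of_isSimpleModule
    (hB : ∀ p : Nat.Primes, p ∉ s → IsUnit ((p : ℕ) : B)) {K : Type*} [AddCommGroup K]
    [Module B K] [Finite K] [IsSimpleModule B K] (k : K) :
    (∏ p ∈ s, ((p : ℕ) : ℤ)) • k = 0 := by
  have := IsSimpleModule.nontrivial B K
  obtain ⟨p, hp, y, hy, hpy⟩ := exists_mem_nsmul_eq_zero hB K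
  refine prod_zsmul_eq_zero hp ?_
  obtain ⟨b, rfl⟩ := IsSimpleModule.toSpanSingleton_surjective B hy k
  rw [LinearMap.toSpanSingleton_apply, smul_comm, hpy, smul_zero]

theorem subsingleton_of_surjective_prod_zsmul
    (hB : ∀ p : Nat.Primes, p ∉ s → IsUnit ((p : ℕ) : B)) {Y : Type*} [AddCommGroup Y]
    [Module B Y] [Finite Y]
    (hY : Function.Surjective fun y : Y => (∏ p ∈ s, ((p : ℕ) : ℤ)) • y) : Subsingleton Y := by
  by_contra hY_ne
  rw [not_subsingleton_iff_nontrivial] at hY_ne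
  obtain ⟨p, hp, y, hy, hpy⟩ := exists_mem_nsmul_eq_zero hB Y
  refine hy (Finite.injective_iff_surjective.mpr hY ?_)
  simp only [prod_zsmul_eq_zero hp hpy, smul_zero]

end PrimesOfRing

theorem natCard_range_smul_eq_mul {R M E F : Type*} [Ring R] [AddCommGroup M] [Module R M]
    [AddCommGroup E] [Module R E] [AddCommGroup F] [Module R F] {a : R}
    (ha : IsIdempotentElem a) {ι : M →ₗ[R] E} {π : E →ₗ[R] F} (hι : Function.Injective ι)
    (hex : Function.Exact ι π) (hπ : Function.Surjective π) :
    Nat.card (Set.range fun x : E => a • x) =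
      Nat.card (Set.range fun x : F => a • x) * Nat.card (Set.range fun x : M => a • x) := by
  let aE := (DistribSMul.toAddMonoidHom E a).range
  have hmap : aE.map π.toAddMonoidHom = (DistribSMul.toAddMonoidHom F a).range := by
    ext y
    constructor
    · rintro ⟨_, ⟨x, rfl⟩, rfl⟩
      exact ⟨π x, (map_smul π a x).symm⟩
    · rintro ⟨y, rfl⟩
      obtain ⟨x, rfl⟩ := hπ y
      exact ⟨a • x, ⟨x, rfl⟩, map_smul π a x⟩
  have hker : π.toAddMonoidHom.ker ⊓ aE =
      (DistribSMul.toAddMonoidHom M a).range.map ι.toAddMonoidHom := by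
    ext x
    constructor
    · rintro ⟨hx, y, rfl⟩
      obtain ⟨z, hz⟩ := (hex _).mp hx
      exact ⟨a • z, ⟨z, rfl⟩, by
        rw [LinearMap.toAddMonoidHom_coe, map_smul, hz, DistribSMul.toAddMonoidHom_apply,
          smul_smul, ha.eq]⟩
    · rintro ⟨_, ⟨z, rfl⟩, rfl⟩
      exact ⟨(hex _).mpr ⟨_, rfl⟩, ι z, (map_smul ι a z).symm⟩
  have hcard := AddSubgroup.relIndex_mul_relIndex ⊥ (π.toAddMonoidHom.ker ⊓ aE) aE bot_le
    inf_le_right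
  rw [AddSubgroup.inf_relIndex_right, AddSubgroup.relIndex_ker, AddSubgroup.relIndex_bot_left,
    AddSubgroup.relIndex_bot_left, hmap, hker, AddSubgroup.card_map_of_injective hι] at hcard
  exact hcard.symm.trans (mul_comm _ _)

section MaximalOrder

variable {A : Type*} [Ring A] [Algebra ℚ A] {S : Set Nat.Primes} {O : Subalgebra (ZS S) A}

theorem isUnit_natCast_of_notMem (O : Subalgebra (ZS S) A) {p : Nat.Primes} (hp : p ∉ S) :
    IsUnit ((p : ℕ) : O) := by
  have hp_mem : ((p : ℕ) : ℤ) ∈ awayFrom S :=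
    ⟨Nat.cast_ne_zero.mpr p.2.ne_zero, fun q hq hqp => hp <| by
      have hqp_nat : (q : ℕ) ∣ p := Int.natCast_dvd_natCast.mp hqp
      rwa [← Subtype.ext ((Nat.prime_dvd_prime_iff_eq q.2 p.2).mp hqp_nat)]⟩
  simpa only [Int.cast_natCast, map_natCast] using
    (isUnit_intCast_of_mem_awayFrom hp_mem).map (algebraMap (ZS S) O)

theorem IsMaximalOrder.isCohenLenstraRing (hS : S.Finite) (hO : IsMaximalOrder O) :
    IsCohenLenstraRing O where
  finite_of_zsmul_eq_zero n hn Y _ _ _ h := by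
    have : Module.Finite (ZS S) O := Module.Finite.iff_fg.mpr hO.prop.fg
    have := finite_quotient_span_intCast S hn
    exact finite_of_zsmul_eq_zero (n := n) (R := ZS S) (A := O) h
  natCard_hom_eq K _ d N _ := by
    have : Module.Finite (ZS S) O := Module.Finite.iff_fg.mpr hO.prop.fg
    exact natCard_hom_eq_of_finite_quotient (fun n hn => finite_quotient_span_intCast S hn)
      hO.maxIdealsInvertible N
  exists_radical := by
    have hunit (p : Nat.Primes) (hp : p ∉ hS.toFinset) : IsUnit ((p : ℕ) : O) :=
      isUnit_natCast_of_notMem O (mt hS.mem_toFinset.mpr hp)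
    exact ⟨∏ p ∈ hS.toFinset, ((p : ℕ) : ℤ),
      Finset.prod_ne_zero_iff.mpr fun p _ => Nat.cast_ne_zero.mpr p.2.ne_zero,
      fun K _ k => prod_zsmul_eq_zero_of_isSimpleModule hunit k,
      fun Y hY => subsingleton_of_surjective_prod_zsmul hunit hY⟩

theorem isWeight_powU (hO : IsMaximalOrder O) {m : ℕ} (e : Fin m ≃ irreducibleCentralIdempotents A)
    {u : Fin m → ℚ} (hu : ∀ i, 0 ≤ u i) : IsWeight (powU hO e u) where
  one_le G := by
    refine Finset.one_le_prod fun i _ => Real.one_le_rpow ?_ (Rat.cast_nonneg.mpr (hu i))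
    have : Nonempty (Set.range fun g : G =>
      (⟨(e i : A), hO.mem_of_central (e i).2.idem (e i).2.central⟩ : O) • g) := ⟨⟨_, 0, rfl⟩⟩
    exact_mod_cast Nat.card_pos
  eq_mul_of_exact hι hex hπ := by
    rw [powU, powU, powU, ← Finset.prod_mul_distrib]
    refine Finset.prod_congr rfl fun i _ => ?_
    have he : IsIdempotentElem
        (⟨(e i : A), hO.mem_of_central (e i).2.idem (e i).2.central⟩ : O) :=
      Subtype.ext (e i).2.idem
    rw [← Real.mul_rpow (Nat.cast_nonneg _) (Nat.cast_nonneg _), ← Nat.cast_mul,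
      natCard_range_smul_eq_mul he hι hex hπ]

end MaximalOrder

end CLM

end

theorem mainTheorem3_general {R : Type*} [Ring R] (hR : CLM.IsCohenLenstraRing R)
    {W : CLM.FiniteModule R → ℝ} (hW : CLM.IsWeight W) {Ω : ℕ → Type*}
    [∀ n, MeasurableSpace (Ω n)] (P : ∀ n, Measure (Ω n)) [∀ n, IsProbabilityMeasure (P n)]
    (X : ∀ n, Ω n → CLM.FiniteModule R) (hX : ∀ n, CLM.IsRandomModule (X n))
    (hmom : ∀ G : CLM.FiniteModule R,
      Tendsto (fun n => ∫⁻ ω, (CLM.surCard (X n ω) G : ℝ≥0∞) ∂(P n)) atTop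
        (𝓝 (ENNReal.ofReal (1 / W G)))) :
    Summable (fun c : CLM.IsoClass R => 1 / (W c.rep * CLM.autCard c.rep)) ∧
    (∀ G : CLM.FiniteModule R,
      Tendsto (fun n => (P n).real {ω | CLM.Iso (X n ω) G}) atTop
        (𝓝 (1 / (CLM.autCard G * W G *
          ∑' c : CLM.IsoClass R, 1 / (W c.rep * CLM.autCard c.rep))))) ∧
    (∃! p : PMF (CLM.IsoClass R), ∀ G₁ G₂ : CLM.FiniteModule R,
      (p (CLM.isoClass G₁)).toReal / (p (CLM.isoClass G₂)).toReal =
        (W G₂ * CLM.autCard G₂) / (W G₁ * CLM.autCard G₁)) ∧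
    (∀ p : PMF (CLM.IsoClass R), (∀ G₁ G₂ : CLM.FiniteModule R,
      (p (CLM.isoClass G₁)).toReal / (p (CLM.isoClass G₂)).toReal =
        (W G₂ * CLM.autCard G₂) / (W G₁ * CLM.autCard G₁)) →
      ∀ G : CLM.FiniteModule R,
        Tendsto (fun n => (P n).real {ω | CLM.Iso (X n ω) G}) atTop
          (𝓝 (p (CLM.isoClass G)).toReal)) := by
  have := hR.countable_isoClass
  obtain ⟨hmass, hlim⟩ := CLM.tendsto_iso_of_moments hR hW hX fun G =>
    CLM.momentLimit_surCard hX (hW.one_div_pos G).le (hmom G)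
  simp only [← CLM.mass_div W, ← CLM.mass_div_mass W]
  exact ⟨hmass, hlim, CLM.existsUnique_pmf_ratio hW hmass, fun p hp G =>
    (CLM.pmf_ratio_iff hW hmass p).mp hp G ▸ hlim G⟩

theorem mainTheorem3
    {A : Type*} [Ring A] [Algebra ℚ A] [FiniteDimensional ℚ A] [IsSemisimpleRing A]
    {m : ℕ} (e : Fin m ≃ CLM.irreducibleCentralIdempotents A)
    (S : Set Nat.Primes) (hS : S.Finite)
    (O : Subalgebra (CLM.ZS S) A) (hO : CLM.IsMaximalOrder O)
    (u : Fin m → ℚ) (hu : ∀ i, 0 ≤ u i)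
    {Ω : ℕ → Type*} [∀ n, MeasurableSpace (Ω n)]
    (P : ∀ n, Measure (Ω n)) [∀ n, IsProbabilityMeasure (P n)]
    (X : ∀ n, Ω n → CLM.FiniteModule O) (hX : ∀ n, CLM.IsRandomModule (X n))
    (hmom : ∀ G : CLM.FiniteModule O,
      Tendsto (fun n => ∫⁻ ω, (CLM.surCard (X n ω) G : ℝ≥0∞) ∂(P n)) atTop
        (𝓝 (ENNReal.ofReal (1 / CLM.powU hO e u G)))) :
    Summable (fun c : CLM.IsoClass O => 1 / (CLM.powU hO e u c.rep * CLM.autCard c.rep)) ∧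
    (∀ G : CLM.FiniteModule O,
      Tendsto (fun n => (P n).real {ω | CLM.Iso (X n ω) G}) atTop
        (𝓝 (1 / (CLM.autCard G * CLM.powU hO e u G * CLM.Z hO e u)))) ∧
    (∃! p : PMF (CLM.IsoClass O), CLM.IsCohenLenstraMartinet hO e u p) ∧
    (∀ p : PMF (CLM.IsoClass O), CLM.IsCohenLenstraMartinet hO e u p →
      ∀ G : CLM.FiniteModule O,
        Tendsto (fun n => (P n).real {ω | CLM.Iso (X n ω) G}) atTop
          (𝓝 (p (CLM.isoClass G)).toReal)) :=
  mainTheorem3_general (hO.isCohenLenstraRing hS) (CLM.isWeight_powU hO e hu) P X hX hmom
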